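/- **Guaranteed scoring games.** A (finite) scoring game is a finite tree $G=\langle G^{\mathcal L}\mid G^{\mathcal R}\rangle$, where each of $G^{\mathcal L}$, $G^{\mathcal R}$ is either a nonempty finite set of scoring games (the Left, respectively Right, options) or an atom $\emptyset^s$, $s\in\mathbb R$, meaning that the player has no move and that, if it is his or her turn, the score is $s$. Two games are equal if they have identical trees, atoms included. The followers of $G$ are $G$, its options, the options of these, and so on. $G$ is *guaranteed* if in each follower $F=\langle\emptyset^{\ell}\mid F^{\mathcal R}\rangle$ every atom $\emptyset^s$ occurring in $F$ has $\ell\le s$, and in each follower $F=\langle F^{\mathcal L}\mid\emptyset^{r}\rangle$ every atom $\emptyset^s$ occurring in $F$ has $s\le r$. Let $\mathbb{GS}$ be the set of guaranteed games. The disjunctive sum $G+H$ has as Left options all $G^L+H$ and $G+H^L$; if $G^{\mathcal L}=\emptyset^{a}$ and $H^{\mathcal L}=\emptyset^{b}$, then $(G+H)^{\mathcal L}=\emptyset^{a+b}$; likewise for Right. It makes $\mathbb{GS}$ a commutative monoid. Write $s=\langle\emptyset^s\mid\emptyset^s\rangle$ for $s\in\mathbb R$; $\widehat 0=0$ and $\widehat{n+1}=\langle\widehat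 n\mid\emptyset^0\rangle$; and let $G-\widehat n$ be the sum of $G$ and the game $\widehat n$ with the roles of the players interchanged (which negates the scores). The stops are $Ls(G)=\ell$ if $G^{\mathcal L}=\emptyset^\ell$, otherwise $Ls(G)=\max_{G^L}Rs(G^L)$; and $Rs(G)=r$ if $G^{\mathcal R}=\emptyset^r$, otherwise $Rs(G)=\min_{G^R}Ls(G^R)$. Put $\underline{Ls}(G)=\min_{n\ge0}Ls(G-\widehat n)$ and $\underline{Rs}(G)=\min_{n\ge0}Rs(G-\widehat n)$. Write $G\succcurlyeq H$ if $Ls(G+X)\ge Ls(H+X)$ and $Rs(G+X)\ge Rs(H+X)$ for all $X\in\mathbb{GS}$, and $G\sim H$ if $G\succcurlyeq H\succcurlyeq G$. The relation $\sim$ is a congruence on $(\mathbb{GS},+)$. **Reductions.** For Left there are the following reductions of a game $G$. Call a Left option $A$ of $G$ reversible through $B\in A^{\mathcal R}$ if $G\succcurlyeq B$. 1. If $A\ne B$ are Left options of $G$ and $B\succcurlyeq A$, erase $A$. 2. If $A$ is reversible through $B$ and $B$ has Left options, replace $A$ by all Left options of $B$. 3. Let $A$ be reversible through $B=\langle\emptyset^\ell\mid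 B^{\mathcal R}\rangle$. (a) If $\underline{Ls}(G)=\underline{Rs}(C)$ for some Left option $C\neq A$ of $G$, erase $A$. (b) If $\underline{Ls}(G)=\underline{Rs}(A)>\underline{Rs}(C)$ for all Left options $C\ne A$ of $G$, replace $A$ by $\langle\emptyset^\ell\mid B\rangle$; or replace $A$ by $\ell-\widehat{n+1}$, where $n\ge0$ is least with $G\succcurlyeq\ell-\widehat n$; or, if $A$ is the only Left option of $G$ and $\langle\emptyset^\ell\mid G^{\mathcal R}\rangle$ is guaranteed, replace $G$ by $\langle\emptyset^\ell\mid G^{\mathcal R}\rangle$. The reductions for Right are the same with the roles of the players interchanged. A game is *reduced* if no reduction applied to it or to any of its followers changes that game. A *reduced form* of $G\in\mathbb{GS}$ is a reduced $K\in\mathbb{GS}$ with $K\sim G$. **Corollary (Canonical Form).** Every $G\in\mathbb{GS}$ has a unique reduced form, and this reduced form can be obtained from $G$ by finitely many reductions, each applied to the current game or at one of its followers. Consequently every congruence class of the quotient monoid $\mathbb{GS}/{\sim}$ contains exactly one reduced game. -/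

import Mathlib

namespace ScoringGame

open scoped Classical

/-! ### Game trees -/

/-- What one player finds at a position: either an atom `∅ˢ` carrying the score `s`
(the player has no move), or a nonempty finite set of options. -/
inductive Side (α : Type) : Type
  | atom (s : ℝ) : Side α
  | options (S : Finset α) (hS : S.Nonempty) : Side α

namespace Side

variable {α β γ : Type}

/-- The set of options (empty for an atom). -/
def set : Side α → Finset α
  | atom _ => ∅
  | options S _ => S

@[simp] theorem set_atom (s : ℝ) : (atom s : Side α).set = ∅ := rfl

@[simp] theorem set_options (S : Finset α) (hS : S.Nonempty) : (options S hS).set = S := rfl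

/-- Apply a function to all options, keeping atoms. -/
noncomputable def map (f : α → β) : Side α → Side β
  | atom s => atom s
  | options S hS => options (S.image f) (hS.image f)

/-- Apply a function, defined on the options only, to all options, keeping atoms. -/
noncomputable def attachMap : (a : Side α) → (∀ x ∈ a.set, β) → Side β
  | atom s, _ => atom s
  | options S hS, f => options (S.attach.image fun x => f x.1 x.2) (hS.attach.image _)

/-- Negate the score of an atom, keeping options. -/
def negAtom : Side α → Side α
  | atom s => atom (-s)
  | options S hS => options S hS

/-- One side of a disjunctive sum: scores are added if both sides are atoms; otherwise the
options are the images of the options of the two sides. -/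
noncomputable def sum : (a b : Side α) → (∀ x ∈ a.set, β) → (∀ y ∈ b.set, β) → Side β
  | atom s, atom t, _, _ => atom (s + t)
  | atom _, options T hT, _, g => options (T.attach.image fun y => g y.1 y.2) (hT.attach.image _)
  | options S hS, atom _, f, _ => options (S.attach.image fun x => f x.1 x.2) (hS.attach.image _)
  | options S hS, options T _, f, g =>
      options ((S.attach.image fun x => f x.1 x.2) ∪ T.attach.image fun y => g y.1 y.2)
        ((hS.attach.image _).mono Finset.subset_union_left)

theorem ext_iff' {a b : Side α} :
    a = b ↔ a.set = b.set ∧ ∀ s, a = atom s ↔ b = atom s := by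
  constructor
  · rintro rfl; simp
  · rintro ⟨h, h'⟩
    cases a with
    | atom s => exact ((h' s).1 rfl).symm
    | options S hS =>
      cases b with
      | atom t => exact absurd h (by simpa using hS.ne_empty)
      | options T hT => simp only [set_options] at h; subst h; rfl

theorem set_eq_empty {a : Side α} : a.set = ∅ ↔ ∃ s, a = atom s := by
  cases a with
  | atom s => simp
  | options S hS => simpa using hS.ne_empty

@[simp] theorem mem_set_attachMap (a : Side α) (f : ∀ x ∈ a.set, β) (z : β) :
    z ∈ (a.attachMap f).set ↔ ∃ x, ∃ hx : x ∈ a.set, f x hx = z := by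
  cases a <;> simp [attachMap]

@[simp] theorem attachMap_eq_atom (a : Side α) (f : ∀ x ∈ a.set, β) (u : ℝ) :
    a.attachMap f = atom u ↔ a = atom u := by
  cases a <;> simp [attachMap]

@[simp] theorem mem_set_map (a : Side α) (f : α → β) (z : β) :
    z ∈ (a.map f).set ↔ ∃ x ∈ a.set, f x = z := by
  cases a <;> simp [map]

@[simp] theorem map_eq_atom (a : Side α) (f : α → β) (u : ℝ) :
    a.map f = atom u ↔ a = atom u := by
  cases a <;> simp [map]

@[simp] theorem mem_set_sum (a b : Side α) (f : ∀ x ∈ a.set, β) (g : ∀ y ∈ b.set, β) (z : β) :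
    z ∈ (sum a b f g).set ↔
      (∃ x, ∃ hx : x ∈ a.set, f x hx = z) ∨ ∃ y, ∃ hy : y ∈ b.set, g y hy = z := by
  cases a <;> cases b <;> simp [sum]

@[simp] theorem sum_eq_atom (a b : Side α) (f : ∀ x ∈ a.set, β) (g : ∀ y ∈ b.set, β) (u : ℝ) :
    sum a b f g = atom u ↔ ∃ s t, a = atom s ∧ b = atom t ∧ s + t = u := by
  cases a <;> cases b <;> simp [sum]

theorem attachMap_map (a : Side α) (f : ∀ x ∈ a.set, β) (g : β → γ) :
    (a.attachMap f).map g = a.attachMap (fun x hx => g (f x hx)) := by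
  rw [ext_iff']
  refine ⟨?_, by simp⟩
  ext z
  simp only [mem_set_map, mem_set_attachMap]
  constructor
  · rintro ⟨_, ⟨x, hx, rfl⟩, rfl⟩; exact ⟨x, hx, rfl⟩
  · rintro ⟨x, hx, rfl⟩; exact ⟨_, ⟨x, hx, rfl⟩, rfl⟩

theorem exists_shape (a : Side α) :
    ∃ (t : Side ℕ) (f : ∀ x ∈ t.set, α), t.attachMap f = a := by
  cases a with
  | atom s => exact ⟨atom s, fun x hx => absurd hx (by simp), rfl⟩
  | options S hS =>
    have e := S.equivFin
    refine ⟨options (Finset.range S.card) (by simpa using hS.ne_empty),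
      fun i hi => (e.symm ⟨i, Finset.mem_range.1 hi⟩).1, ?_⟩
    rw [ext_iff']
    refine ⟨?_, fun s => by simp [attachMap]⟩
    ext x
    rw [mem_set_attachMap]
    constructor
    · rintro ⟨i, hi, rfl⟩; exact (e.symm _).2
    · intro hx
      exact ⟨(e ⟨x, hx⟩).1, Finset.mem_range.2 (e ⟨x, hx⟩).2, by simp⟩

end Side

/-- The shape of a single position with options in `α`: Left's side and Right's side. -/
def Position (α : Type) : Type := Side α × Side α

noncomputable instance : Functor Position where
  map f p := (p.1.map f, p.2.map f)

/-- The game trees are the initial algebra of `Position`, which exists because `Position` is a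
quotient of a polynomial functor. -/
noncomputable instance : QPF Position where
  P := ⟨Side ℕ × Side ℕ, fun t => {x // x ∈ t.1.set} ⊕ {x // x ∈ t.2.set}⟩
  abs p := (p.1.1.attachMap fun x hx => p.2 (.inl ⟨x, hx⟩),
    p.1.2.attachMap fun x hx => p.2 (.inr ⟨x, hx⟩))
  repr p := ⟨(p.1.exists_shape.choose, p.2.exists_shape.choose),
    Sum.elim (fun x => p.1.exists_shape.choose_spec.choose x.1 x.2)
      (fun x => p.2.exists_shape.choose_spec.choose x.1 x.2)⟩
  abs_repr p := Prod.ext p.1.exists_shape.choose_spec.choose_spec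
    p.2.exists_shape.choose_spec.choose_spec
  abs_map f p := by
    obtain ⟨t, g⟩ := p
    exact Prod.ext (Side.attachMap_map _ _ f).symm (Side.attachMap_map _ _ f).symm

/-- The general (finite) scoring games: finite trees in which the options of a position form
two finite sets and every missing set of options is adorned with a real score. Equality of such
games is identity of game trees, together with all their atoms. -/
def SGame : Type := QPF.Fix Position

namespace SGame

/-- The game `⟨l ∣ r⟩`. -/
noncomputable def mk (l r : Side SGame) : SGame := QPF.Fix.mk (F := Position) (l, r)

/-- Left's side of a game. -/
noncomputable def left (G : SGame) : Side SGame := (QPF.Fix.dest (F := Position) G).1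

/-- Right's side of a game. -/
noncomputable def right (G : SGame) : Side SGame := (QPF.Fix.dest (F := Position) G).2

@[simp] theorem left_mk (l r : Side SGame) : (mk l r).left = l := by
  unfold mk left
  exact congrArg Prod.fst (QPF.Fix.dest_mk (F := Position) (l, r))

@[simp] theorem right_mk (l r : Side SGame) : (mk l r).right = r := by
  unfold mk right
  exact congrArg Prod.snd (QPF.Fix.dest_mk (F := Position) (l, r))

@[simp] theorem mk_eta (G : SGame) : mk G.left G.right = G :=
  QPF.Fix.mk_dest (F := Position) G

theorem ext {G H : SGame} (hl : G.left = H.left) (hr : G.right = H.right) : G = H := by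
  rw [← mk_eta G, ← mk_eta H, hl, hr]

/-- The finite set of Left options. -/
noncomputable def leftOptions (G : SGame) : Finset SGame := G.left.set

/-- The finite set of Right options. -/
noncomputable def rightOptions (G : SGame) : Finset SGame := G.right.set

/-- `H` is an option of `G`. -/
def IsOption (H G : SGame) : Prop := H ∈ G.leftOptions ∨ H ∈ G.rightOptions

theorem isOption_left {H G : SGame} (h : H ∈ G.left.set) : IsOption H G := Or.inl h

theorem isOption_right {H G : SGame} (h : H ∈ G.right.set) : IsOption H G := Or.inr h

/-- Induction along options. -/
theorem induction {p : SGame → Prop} (h : ∀ G, (∀ H, IsOption H G → p H) → p G) (G : SGame) :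
    p G := by
  refine QPF.Fix.ind (F := Position) p ?_ G
  rintro x ⟨u, rfl⟩
  refine h (mk (u.1.map Subtype.val) (u.2.map Subtype.val)) ?_
  rintro H (hH | hH)
  · rw [leftOptions, left_mk] at hH
    obtain ⟨y, -, rfl⟩ := (Side.mem_set_map _ _ _).1 hH
    exact y.2
  · rw [rightOptions, right_mk] at hH
    obtain ⟨y, -, rfl⟩ := (Side.mem_set_map _ _ _).1 hH
    exact y.2

theorem wellFounded_isOption : WellFounded IsOption :=
  ⟨fun G => induction (fun G h => Acc.intro G h) G⟩

instance : WellFoundedRelation SGame := ⟨IsOption, wellFounded_isOption⟩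

/-- `F` is a follower of `G`: it is reached from `G` by finitely many moves (possibly none),
not necessarily alternating. -/
def IsFollower (F G : SGame) : Prop := Relation.ReflTransGen IsOption F G

/-- The atom `∅ˢ` occurs in `G`. -/
def HasAtom (G : SGame) (s : ℝ) : Prop :=
  ∃ F, IsFollower F G ∧ (F.left = .atom s ∨ F.right = .atom s)

/-- Guaranteed games: in every left-atomic follower `⟨∅ˡ ∣ ⋯⟩`, `l` is at most every score in
that follower, and in every right-atomic follower `⟨⋯ ∣ ∅ʳ⟩`, `r` is at least every score in
that follower. (For a purely atomic follower `⟨∅ˡ ∣ ∅ʳ⟩` both clauses say `l ≤ r`.) -/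
def Guaranteed (G : SGame) : Prop :=
  ∀ F, IsFollower F G →
    (∀ l, F.left = .atom l → ∀ s, F.HasAtom s → l ≤ s) ∧
    (∀ r, F.right = .atom r → ∀ s, F.HasAtom s → s ≤ r)

/-! ### Disjunctive sum, numbers, conjugates, waiting moves -/

/-- The disjunctive sum. -/
noncomputable def add (G H : SGame) : SGame :=
  mk (Side.sum G.left H.left (fun x _ => add x H) (fun y _ => add G y))
    (Side.sum G.right H.right (fun x _ => add x H) (fun y _ => add G y))
termination_by (G, H)
decreasing_by
  · exact Prod.Lex.left _ _ (isOption_left ‹_›)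
  · exact Prod.Lex.right _ (isOption_left ‹_›)
  · exact Prod.Lex.left _ _ (isOption_right ‹_›)
  · exact Prod.Lex.right _ (isOption_right ‹_›)

noncomputable instance : Add SGame := ⟨add⟩

/-- The number `s`, that is, the game `⟨∅ˢ ∣ ∅ˢ⟩`. -/
noncomputable def number (s : ℝ) : SGame := mk (.atom s) (.atom s)

noncomputable instance : Zero SGame := ⟨number 0⟩

/-- The conjugate of a game: the roles of Left and Right are interchanged. -/
noncomputable def conj (G : SGame) : SGame :=
  mk (G.right.attachMap fun x _ => conj x).negAtom (G.left.attachMap fun x _ => conj x).negAtom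
termination_by G
decreasing_by
  · exact isOption_right ‹_›
  · exact isOption_left ‹_›

/-- The waiting moves `n̂`: `0̂ = 0` and the next one after `n̂` is `⟨n̂ ∣ ∅⁰⟩`. -/
noncomputable def wait : ℕ → SGame
  | 0 => 0
  | n + 1 => mk (.options {wait n} (Finset.singleton_nonempty _)) (.atom 0)

/-- The game `G - n̂`, that is, `G` plus the conjugate of the waiting move `n̂`. -/
noncomputable def subWait (G : SGame) (n : ℕ) : SGame := G + conj (wait n)

/-! ### Stops and order -/

mutual

/-- The Left-stop. -/
noncomputable def Ls (G : SGame) : ℝ :=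
  match h : G.left with
  | .atom s => s
  | .options S hS => S.attach.sup' hS.attach fun x => Rs x.1
termination_by G
decreasing_by
  exact isOption_left (by rw [h]; exact x.2)

/-- The Right-stop. -/
noncomputable def Rs (G : SGame) : ℝ :=
  match h : G.right with
  | .atom s => s
  | .options S hS => S.attach.inf' hS.attach fun x => Ls x.1
termination_by G
decreasing_by
  exact isOption_right (by rw [h]; exact x.2)

end

/-- Right's pass-allowed Left-stop, `min {Ls (G - n̂) : n ∈ ℕ}`. (The sums `G - n̂` have, for all
`n` together, only finitely many scores, so the infimum is a minimum.) -/
noncomputable def passLs (G : SGame) : ℝ := ⨅ n : ℕ, Ls (subWait G n)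

/-- Right's pass-allowed Right-stop, `min {Rs (G - n̂) : n ∈ ℕ}`. -/
noncomputable def passRs (G : SGame) : ℝ := ⨅ n : ℕ, Rs (subWait G n)

/-- `G ≽ H`, defined by comparing stops in all sums with guaranteed games. -/
def Succeq (G H : SGame) : Prop :=
  ∀ X, Guaranteed X → Ls (H + X) ≤ Ls (G + X) ∧ Rs (H + X) ≤ Rs (G + X)

/-- `G ∼ H`. -/
def Equivalent (G H : SGame) : Prop := Succeq G H ∧ Succeq H G

/-! ### Reductions -/

/-- `A` is a Left option of `G`, reversible through its Right option `B`. -/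
def LeftReversible (G A B : SGame) : Prop :=
  A ∈ G.leftOptions ∧ B ∈ A.rightOptions ∧ Succeq G B

/-- Every Left option of `G` other than `A` has a smaller Right's pass-allowed Right-stop than
`A`, for which this stop is Right's pass-allowed Left-stop of `G`. -/
def OnlyBest (G A : SGame) : Prop :=
  passLs G = passRs A ∧ ∀ C ∈ G.leftOptions, C ≠ A → passRs C < passRs A

/-- `LeftReduction G H`: one of the reductions for Left, applied to the position `G` itself,
yields `H`. -/
inductive LeftReduction : SGame → SGame → Prop
  /-- Erase a dominated option. -/
  | dominated {G A B : SGame} (hA : A ∈ G.leftOptions) (hB : B ∈ G.leftOptions) (hne : A ≠ B)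
      (h : Succeq B A) (hS : (G.leftOptions.erase A).Nonempty) :
      LeftReduction G (mk (.options (G.leftOptions.erase A) hS) G.right)
  /-- Bypass a non-atomic-reversible option: replace it by the Left options of the
  reversing option. -/
  | bypass {G A B : SGame} (h : LeftReversible G A B) (hB : B.leftOptions.Nonempty)
      (hS : (G.leftOptions.erase A ∪ B.leftOptions).Nonempty) :
      LeftReduction G (mk (.options (G.leftOptions.erase A ∪ B.leftOptions) hS) G.right)
  /-- Erase an atomic-reversible option, if another option is as good when Right may pass. -/
  | eraseAtomic {G A B C : SGame} {l : ℝ} (h : LeftReversible G A B) (hB : B.left = .atom l)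
      (hC : C ∈ G.leftOptions) (hne : C ≠ A) (hCG : passLs G = passRs C)
      (hS : (G.leftOptions.erase A).Nonempty) :
      LeftReduction G (mk (.options (G.leftOptions.erase A) hS) G.right)
  /-- Otherwise, replace an atomic-reversible option by `⟨∅ˡ ∣ B⟩`. -/
  | replaceAtomic {G A B : SGame} {l : ℝ} (h : LeftReversible G A B) (hB : B.left = .atom l)
      (hA : OnlyBest G A) :
      LeftReduction G
        (mk (.options (insert (mk (.atom l) (.options {B} (Finset.singleton_nonempty B)))
          (G.leftOptions.erase A)) (Finset.insert_nonempty _ _)) G.right)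
  /-- In the same situation, replace an atomic-reversible option by `l` minus the waiting move
  of `n + 1`, for the least `n` with `G ≽ l - n̂`. -/
  | substituteWait {G A B : SGame} {l : ℝ} {n : ℕ} (h : LeftReversible G A B)
      (hB : B.left = .atom l) (hA : OnlyBest G A)
      (hn : IsLeast {m : ℕ | Succeq G (subWait (number l) m)} n) :
      LeftReduction G
        (mk (.options (insert (subWait (number l) (n + 1)) (G.leftOptions.erase A))
          (Finset.insert_nonempty _ _)) G.right)
  /-- In the same situation, replace the only Left option by the atom `∅ˡ`, if the result is
  guaranteed. -/
  | substituteAtom {G A B : SGame} {l : ℝ} (h : LeftReversible G A B)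
      (hB : B.left = .atom l) (hA : OnlyBest G A) (hG : G.leftOptions = {A})
      (hguar : Guaranteed (mk (.atom l) G.right)) :
      LeftReduction G (mk (.atom l) G.right)

/-- A reduction for Left, or for Right (the same with the roles of the players interchanged),
applied to the position `G` itself, yields `H`. -/
def Reduction (G H : SGame) : Prop := LeftReduction G H ∨ LeftReduction (conj G) (conj H)

/-- `G` is reduced: no reduction changes `G` or any of its followers. -/
def IsReduced (G : SGame) : Prop := ∀ F, IsFollower F G → ∀ H, Reduction F H → H = F

/-- One step of reducing `G`: apply a reduction to one occurrence of a follower of `G`. -/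
inductive Step : SGame → SGame → Prop
  | here {G H : SGame} (h : Reduction G H) : Step G H
  | inLeft {G A B : SGame} (hA : A ∈ G.leftOptions) (h : Step A B) :
      Step G (mk (.options (insert B (G.leftOptions.erase A)) (Finset.insert_nonempty _ _)) G.right)
  | inRight {G A B : SGame} (hA : A ∈ G.rightOptions) (h : Step A B) :
      Step G (mk G.left (.options (insert B (G.rightOptions.erase A)) (Finset.insert_nonempty _ _)))

/-- `H` is obtained from `G` by finitely many (possibly no) reductions. -/
def ReducesTo (G H : SGame) : Prop := Relation.ReflTransGen Step G H

/-! ### The monoid of guaranteed games and its congruence -/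

theorem add_def (G H : SGame) : G + H =
    mk (Side.sum G.left H.left (fun x _ => x + H) (fun y _ => G + y))
      (Side.sum G.right H.right (fun x _ => x + H) (fun y _ => G + y)) := by
  change add G H = _
  rw [add]
  rfl

theorem leftOptions_add (G H : SGame) : (G + H).leftOptions =
    G.leftOptions.image (fun x => x + H) ∪ H.leftOptions.image (fun y => G + y) := by
  rw [add_def]
  ext z
  simp [leftOptions]

theorem rightOptions_add (G H : SGame) : (G + H).rightOptions =
    G.rightOptions.image (fun x => x + H) ∪ H.rightOptions.image (fun y => G + y) := by
  rw [add_def]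
  ext z
  simp [rightOptions]

theorem left_add_eq_atom (G H : SGame) (u : ℝ) : (G + H).left = .atom u ↔
    ∃ s t, G.left = .atom s ∧ H.left = .atom t ∧ s + t = u := by
  rw [add_def, left_mk, Side.sum_eq_atom]

theorem right_add_eq_atom (G H : SGame) (u : ℝ) : (G + H).right = .atom u ↔
    ∃ s t, G.right = .atom s ∧ H.right = .atom t ∧ s + t = u := by
  rw [add_def, right_mk, Side.sum_eq_atom]

theorem ext_options {G H : SGame} (hl : G.leftOptions = H.leftOptions)
    (hr : G.rightOptions = H.rightOptions)
    (hla : ∀ s, G.left = .atom s ↔ H.left = .atom s)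
    (hra : ∀ s, G.right = .atom s ↔ H.right = .atom s) : G = H :=
  ext (Side.ext_iff'.2 ⟨hl, hla⟩) (Side.ext_iff'.2 ⟨hr, hra⟩)

protected theorem add_comm' (G H : SGame) : G + H = H + G := by
  induction G using induction generalizing H with
  | h G ihG =>
  induction H using induction with
  | h H ihH =>
  apply ext_options
  · rw [leftOptions_add, leftOptions_add, Finset.union_comm]
    congr 1
    · exact Finset.image_congr fun y hy => ihH y (.inl hy)
    · exact Finset.image_congr fun x hx => ihG x (.inl hx) H
  · rw [rightOptions_add, rightOptions_add, Finset.union_comm]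
    congr 1
    · exact Finset.image_congr fun y hy => ihH y (.inr hy)
    · exact Finset.image_congr fun x hx => ihG x (.inr hx) H
  · intro u
    simp only [left_add_eq_atom]
    constructor <;> rintro ⟨s, t, hs, ht, rfl⟩ <;> exact ⟨t, s, ht, hs, add_comm _ _⟩
  · intro u
    simp only [right_add_eq_atom]
    constructor <;> rintro ⟨s, t, hs, ht, rfl⟩ <;> exact ⟨t, s, ht, hs, add_comm _ _⟩

protected theorem add_assoc' (G H K : SGame) : G + H + K = G + (H + K) := by
  induction G using induction generalizing H K with
  | h G ihG =>
  induction H using induction generalizing K with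
  | h H ihH =>
  induction K using induction with
  | h K ihK =>
  apply ext_options
  · simp only [leftOptions_add, Finset.image_union, Finset.image_image, Finset.union_assoc]
    congr 1
    · exact Finset.image_congr fun x hx => ihG x (.inl hx) H K
    · congr 1
      · exact Finset.image_congr fun x hx => ihH x (.inl hx) K
      · exact Finset.image_congr fun x hx => ihK x (.inl hx)
  · simp only [rightOptions_add, Finset.image_union, Finset.image_image, Finset.union_assoc]
    congr 1
    · exact Finset.image_congr fun x hx => ihG x (.inr hx) H K
    · congr 1
      · exact Finset.image_congr fun x hx => ihH x (.inr hx) K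
      · exact Finset.image_congr fun x hx => ihK x (.inr hx)
  · intro u
    simp only [left_add_eq_atom]
    constructor
    · rintro ⟨_, c, ⟨a, b, ha, hb, rfl⟩, hc, rfl⟩
      exact ⟨a, b + c, ha, ⟨b, c, hb, hc, rfl⟩, (add_assoc a b c).symm⟩
    · rintro ⟨a, _, ha, ⟨b, c, hb, hc, rfl⟩, rfl⟩
      exact ⟨a + b, c, ⟨a, b, ha, hb, rfl⟩, hc, add_assoc a b c⟩
  · intro u
    simp only [right_add_eq_atom]
    constructor
    · rintro ⟨_, c, ⟨a, b, ha, hb, rfl⟩, hc, rfl⟩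
      exact ⟨a, b + c, ha, ⟨b, c, hb, hc, rfl⟩, (add_assoc a b c).symm⟩
    · rintro ⟨a, _, ha, ⟨b, c, hb, hc, rfl⟩, rfl⟩
      exact ⟨a + b, c, ⟨a, b, ha, hb, rfl⟩, hc, add_assoc a b c⟩

theorem left_zero : (0 : SGame).left = .atom 0 := left_mk _ _

theorem right_zero : (0 : SGame).right = .atom 0 := right_mk _ _

protected theorem zero_add' (G : SGame) : 0 + G = G := by
  induction G using induction with
  | h G ih =>
  apply ext_options
  · have h0 : (0 : SGame).leftOptions = ∅ := by simp [leftOptions, left_zero]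
    rw [leftOptions_add, h0, Finset.image_empty, Finset.empty_union]
    exact (Finset.image_congr fun x hx => ih x (.inl hx)).trans Finset.image_id
  · have h0 : (0 : SGame).rightOptions = ∅ := by simp [rightOptions, right_zero]
    rw [rightOptions_add, h0, Finset.image_empty, Finset.empty_union]
    exact (Finset.image_congr fun x hx => ih x (.inr hx)).trans Finset.image_id
  · intro u
    simp [left_add_eq_atom, left_zero]
  · intro u
    simp [right_add_eq_atom, right_zero]

noncomputable instance : AddCommMonoid SGame where
  add_assoc := SGame.add_assoc'
  zero_add := SGame.zero_add'
  add_zero G := by rw [SGame.add_comm', SGame.zero_add']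
  add_comm := SGame.add_comm'
  nsmul := nsmulRec

theorem isOption_add {F G H : SGame} (h : IsOption F (G + H)) :
    (∃ G', IsOption G' G ∧ F = G' + H) ∨ ∃ H', IsOption H' H ∧ F = G + H' := by
  rcases h with h | h
  · rw [leftOptions_add, Finset.mem_union, Finset.mem_image, Finset.mem_image] at h
    rcases h with ⟨x, hx, rfl⟩ | ⟨x, hx, rfl⟩
    · exact .inl ⟨x, .inl hx, rfl⟩
    · exact .inr ⟨x, .inl hx, rfl⟩
  · rw [rightOptions_add, Finset.mem_union, Finset.mem_image, Finset.mem_image] at h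
    rcases h with ⟨x, hx, rfl⟩ | ⟨x, hx, rfl⟩
    · exact .inl ⟨x, .inr hx, rfl⟩
    · exact .inr ⟨x, .inr hx, rfl⟩

theorem isFollower_add {F G H : SGame} (h : IsFollower F (G + H)) :
    ∃ G' H', IsFollower G' G ∧ IsFollower H' H ∧ F = G' + H' := by
  induction h using Relation.ReflTransGen.head_induction_on with
  | refl => exact ⟨G, H, .refl, .refl, rfl⟩
  | head h _ ih =>
    obtain ⟨G', H', hG, hH, rfl⟩ := ih
    rcases isOption_add h with ⟨G'', h', rfl⟩ | ⟨H'', h', rfl⟩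
    · exact ⟨G'', H', .head h' hG, hH, rfl⟩
    · exact ⟨G', H'', hG, .head h' hH, rfl⟩

theorem hasAtom_add {G H : SGame} {u : ℝ} (h : HasAtom (G + H) u) :
    ∃ s t, HasAtom G s ∧ HasAtom H t ∧ s + t = u := by
  obtain ⟨F, hF, hu⟩ := h
  obtain ⟨G', H', hG, hH, rfl⟩ := isFollower_add hF
  rcases hu with hu | hu
  · obtain ⟨s, t, hs, ht, rfl⟩ := (left_add_eq_atom _ _ _).1 hu
    exact ⟨s, t, ⟨G', hG, .inl hs⟩, ⟨H', hH, .inl ht⟩, rfl⟩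
  · obtain ⟨s, t, hs, ht, rfl⟩ := (right_add_eq_atom _ _ _).1 hu
    exact ⟨s, t, ⟨G', hG, .inr hs⟩, ⟨H', hH, .inr ht⟩, rfl⟩

theorem Guaranteed.add {G H : SGame} (hG : Guaranteed G) (hH : Guaranteed H) :
    Guaranteed (G + H) := by
  intro F hF
  obtain ⟨G', H', hG', hH', rfl⟩ := isFollower_add hF
  constructor
  · intro l hl u hu
    obtain ⟨a, b, ha, hb, rfl⟩ := (left_add_eq_atom _ _ _).1 hl
    obtain ⟨s, t, hs, ht, rfl⟩ := hasAtom_add hu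
    exact add_le_add ((hG G' hG').1 a ha s hs) ((hH H' hH').1 b hb t ht)
  · intro l hl u hu
    obtain ⟨a, b, ha, hb, rfl⟩ := (right_add_eq_atom _ _ _).1 hl
    obtain ⟨s, t, hs, ht, rfl⟩ := hasAtom_add hu
    exact add_le_add ((hG G' hG').2 a ha s hs) ((hH H' hH').2 b hb t ht)

theorem guaranteed_zero : Guaranteed (0 : SGame) := by
  have hf : ∀ F, IsFollower F (0 : SGame) → F = 0 := by
    intro F hF
    rcases Relation.ReflTransGen.cases_tail hF with h | ⟨G, _, h⟩
    · exact h.symm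
    · exact absurd h (by simp [IsOption, leftOptions, rightOptions, left_zero, right_zero])
  have ha : ∀ s, HasAtom 0 s → s = 0 := by
    rintro s ⟨F, hF, h⟩
    rw [hf F hF, left_zero, right_zero] at h
    rcases h with h | h <;> (injection h with h; exact h.symm)
  intro F hF
  rw [hf F hF, left_zero, right_zero]
  constructor <;> intro l hl s hs <;> injection hl with hl <;> rw [ha s hs, ← hl]

end SGame

open SGame

/-- The commutative monoid of guaranteed scoring games under disjunctive sum. -/
def GS : AddSubmonoid SGame where
  carrier := {G | Guaranteed G}
  add_mem' := Guaranteed.add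
  zero_mem' := guaranteed_zero

/-- The congruence `∼` on the monoid of guaranteed scoring games. -/
def gsCon : AddCon GS where
  r G H := Equivalent G.1 H.1
  iseqv :=
    { refl := fun _ => ⟨fun _ _ => ⟨le_rfl, le_rfl⟩, fun _ _ => ⟨le_rfl, le_rfl⟩⟩
      symm := fun h => ⟨h.2, h.1⟩
      trans := fun h h' =>
        ⟨fun X hX => ⟨(h'.1 X hX).1.trans (h.1 X hX).1, (h'.1 X hX).2.trans (h.1 X hX).2⟩,
         fun X hX => ⟨(h.2 X hX).1.trans (h'.2 X hX).1, (h.2 X hX).2.trans (h'.2 X hX).2⟩⟩ }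
  add' := by
    have key : ∀ {w x y z : GS}, Succeq w.1 x.1 → Succeq y.1 z.1 →
        Succeq (w.1 + y.1) (x.1 + z.1) := by
      intro w x y z h h' X hX
      have h₁ := h (y.1 + X) (y.2.add hX)
      have h₂ := h' (x.1 + X) (x.2.add hX)
      rw [add_left_comm y.1, add_left_comm z.1, ← add_assoc, ← add_assoc] at h₂
      rw [← add_assoc, ← add_assoc] at h₁
      exact ⟨h₂.1.trans h₁.1, h₂.2.trans h₁.2⟩
    intro w x y z h h'
    exact ⟨key h.1 h'.1, key h.2 h'.2⟩

/-- `K` is a reduced form of `G`: a reduced game that is equivalent to `G`. -/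
def IsReducedForm (K G : GS) : Prop := IsReduced K.1 ∧ Equivalent K.1 G.1

end ScoringGame

/-!
Write `G ≽ H` for `Succeq G H` and `∼` for `Equivalent`. The canonical form theorem rests on a
constructive comparison of guaranteed games. Apart from a condition on atoms, `G ≽ H` holds if
and only if every Left option of `H` is matched by a Left option of `G` that is at least as good
or is reversed, that is, has a Right option `B` with `G ≽ B`; and dually for the Right options of
`G` (`LeftCovers`, `succeq_of_leftCovers`, `Succeq.leftCovers`). Sufficiency is a strategy-copying
induction on the distinguishing game. Its only delicate point is the end of play, where Left has no
move left in `H + X`; there a guaranteed game `X` without Left moves is worth no less than its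
Left atom together with passes for Right (`stops_subWait_add_le`), so that the pass-allowed stop of
`G` decides. Necessity is a linking argument: if an option of `H` is neither matched nor reversed,
the witnesses of these failures assemble to a game separating `G` from `H` (`exists_link`).

*Reductions preserve equivalence* (`Step.sound`): when an option `A` that is reversible through
`B` is bypassed, erased or replaced, the new game still covers the Left side of `B`, hence is at
least `B`, so that `A` is still reversed (`LeftReversible.equivalent`). No reduction creates new
atoms, so the games around it stay guaranteed.

*Reduction terminates* (`exists_isReduced`): a weighted count of nodes, in which the delayed numbers
`l - n̂` weigh less than other games, drops with a suitable reduction whenever any reduction changes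
the game.

*Reduced games are unique in their class* (`eq_of_equivalent_of_isReduced`): by induction the
irreversible options of two equivalent reduced games coincide. A reduced game has at most one
reversible Left option, and this option is `l - m̂` with `l` and `m` determined by the class. If
only one of the games has such an option, then it is that game's only Left option while the other
game has the atom `∅ˡ`; but since the Right sides have the same atoms, the option could then be
replaced by the atom, and the game would not be reduced.

Statements for Right are obtained from those for Left by conjugation.
-/

namespace ScoringGame

open scoped Classical

/-! ### Conjugation -/

namespace Side

variable {α : Type}

@[simp] theorem set_negAtom (a : Side α) : a.negAtom.set = a.set := by
  cases a <;> rfl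

@[simp] theorem negAtom_eq_atom (a : Side α) (u : ℝ) : a.negAtom = atom u ↔ a = atom (-u) := by
  cases a <;> simp [negAtom, neg_eq_iff_eq_neg]

end Side

namespace SGame

theorem leftOptions_nonempty_of_ne {G : SGame} (h : ∀ s, G.left ≠ .atom s) :
    G.leftOptions.Nonempty := by
  by_contra h'
  obtain ⟨s, hs⟩ := Side.set_eq_empty.1 (Finset.not_nonempty_iff_eq_empty.1 h')
  exact h s hs

theorem leftOptions_eq_empty {G : SGame} {s : ℝ} (h : G.left = .atom s) : G.leftOptions = ∅ := by
  simp [leftOptions, h]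

theorem rightOptions_eq_empty {G : SGame} {s : ℝ} (h : G.right = .atom s) :
    G.rightOptions = ∅ := by
  simp [rightOptions, h]

theorem left_ne_atom {G A : SGame} (hA : A ∈ G.leftOptions) (s : ℝ) : G.left ≠ .atom s := by
  intro h
  simp [leftOptions_eq_empty h] at hA

theorem left_eq_options {G : SGame} {S : Finset SGame} (hS : S.Nonempty)
    (h : G.leftOptions = S) : G.left = .options S hS := by
  rw [Side.ext_iff']
  refine ⟨h, fun s => ⟨fun h' => ?_, fun h' => by simp at h'⟩⟩
  rw [leftOptions_eq_empty h'] at h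
  exact absurd h.symm hS.ne_empty

@[simp] theorem leftOptions_mk (l r : Side SGame) : (mk l r).leftOptions = l.set := by
  simp [leftOptions]

@[simp] theorem rightOptions_mk (l r : Side SGame) : (mk l r).rightOptions = r.set := by
  simp [rightOptions]

theorem leftOptions_conj (G : SGame) : (conj G).leftOptions = G.rightOptions.image conj := by
  rw [conj]
  ext z
  simp [rightOptions]

theorem rightOptions_conj (G : SGame) : (conj G).rightOptions = G.leftOptions.image conj := by
  rw [conj]
  ext z
  simp [leftOptions]

theorem left_conj_eq_atom {G : SGame} {u : ℝ} : (conj G).left = .atom u ↔ G.right = .atom (-u) := by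
  rw [conj]
  simp

theorem right_conj_eq_atom {G : SGame} {u : ℝ} :
    (conj G).right = .atom u ↔ G.left = .atom (-u) := by
  rw [conj]
  simp

@[simp] theorem conj_conj (G : SGame) : conj (conj G) = G := by
  induction G using induction with
  | h G ih =>
  apply ext_options
  · rw [leftOptions_conj, rightOptions_conj, Finset.image_image]
    exact (Finset.image_congr fun x hx => ih x (.inl hx)).trans Finset.image_id
  · rw [rightOptions_conj, leftOptions_conj, Finset.image_image]
    exact (Finset.image_congr fun x hx => ih x (.inr hx)).trans Finset.image_id
  · simp [left_conj_eq_atom, right_conj_eq_atom]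
  · simp [left_conj_eq_atom, right_conj_eq_atom]

theorem conj_injective : Function.Injective conj := fun G H h => by
  rw [← conj_conj G, h, conj_conj]

theorem conj_mem_leftOptions_conj {A G : SGame} :
    conj A ∈ (conj G).leftOptions ↔ A ∈ G.rightOptions := by
  rw [leftOptions_conj, Finset.mem_image]
  exact ⟨fun ⟨x, hx, h⟩ => conj_injective h ▸ hx, fun h => ⟨A, h, rfl⟩⟩

theorem conj_mem_rightOptions_conj {A G : SGame} :
    conj A ∈ (conj G).rightOptions ↔ A ∈ G.leftOptions := by
  rw [← conj_mem_leftOptions_conj, conj_conj, conj_conj]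

theorem mem_leftOptions_conj {A G : SGame} :
    A ∈ (conj G).leftOptions ↔ conj A ∈ G.rightOptions := by
  rw [← conj_mem_leftOptions_conj, conj_conj]

theorem mem_rightOptions_conj {A G : SGame} :
    A ∈ (conj G).rightOptions ↔ conj A ∈ G.leftOptions := by
  rw [← conj_mem_rightOptions_conj, conj_conj]

theorem conj_add (G H : SGame) : conj (G + H) = conj G + conj H := by
  induction G using induction generalizing H with
  | h G ihG =>
  induction H using induction with
  | h H ihH =>
  apply ext_options
  · simp only [leftOptions_add, leftOptions_conj, rightOptions_add, Finset.image_union,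
      Finset.image_image]
    congr 1
    · exact Finset.image_congr fun x hx => ihG x (.inr hx) H
    · exact Finset.image_congr fun x hx => ihH x (.inr hx)
  · simp only [leftOptions_add, rightOptions_conj, rightOptions_add, Finset.image_union,
      Finset.image_image]
    congr 1
    · exact Finset.image_congr fun x hx => ihG x (.inl hx) H
    · exact Finset.image_congr fun x hx => ihH x (.inl hx)
  · intro u
    simp only [left_conj_eq_atom, left_add_eq_atom, right_add_eq_atom]
    constructor <;> rintro ⟨s, t, hs, ht, h⟩
    · exact ⟨-s, -t, by simpa, by simpa, by linarith⟩
    · exact ⟨-s, -t, by simpa, by simpa, by linarith⟩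
  · intro u
    simp only [right_conj_eq_atom, left_add_eq_atom, right_add_eq_atom]
    constructor <;> rintro ⟨s, t, hs, ht, h⟩
    · exact ⟨-s, -t, by simpa, by simpa, by linarith⟩
    · exact ⟨-s, -t, by simpa, by simpa, by linarith⟩

theorem isOption_conj {F G : SGame} : IsOption F (conj G) ↔ IsOption (conj F) G := by
  simp only [IsOption, mem_leftOptions_conj, mem_rightOptions_conj, or_comm]

theorem IsFollower.conj {F G : SGame} (h : IsFollower F G) :
    IsFollower (SGame.conj F) (SGame.conj G) :=
  Relation.ReflTransGen.lift SGame.conj (fun a b hab => isOption_conj.2 (by simpa using hab)) _ _ h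

theorem isFollower_conj {F G : SGame} : IsFollower F (conj G) ↔ IsFollower (conj F) G :=
  ⟨fun h => by simpa using h.conj, fun h => by simpa using h.conj⟩

theorem hasAtom_conj {G : SGame} {s : ℝ} : HasAtom (conj G) s ↔ HasAtom G (-s) := by
  have key : ∀ (G : SGame) (s : ℝ), HasAtom (conj G) s → HasAtom G (-s) := by
    rintro G s ⟨F, hF, h⟩
    refine ⟨conj F, isFollower_conj.1 hF, ?_⟩
    rw [left_conj_eq_atom, right_conj_eq_atom, neg_neg]
    exact h.symm
  refine ⟨key G s, fun h => ?_⟩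
  have := key (conj G) (-s) (by simpa using h)
  simpa using this

theorem Guaranteed.conj {G : SGame} (h : Guaranteed G) : Guaranteed (conj G) := by
  intro F hF
  have hF' := h _ (isFollower_conj.1 hF)
  constructor
  · intro l hl s hs
    have := hF'.2 (-l) (by rw [right_conj_eq_atom, neg_neg]; exact hl) (-s)
      (by rw [hasAtom_conj, neg_neg]; exact hs)
    linarith
  · intro l hl s hs
    have := hF'.1 (-l) (by rw [left_conj_eq_atom, neg_neg]; exact hl) (-s)
      (by rw [hasAtom_conj, neg_neg]; exact hs)
    linarith

theorem guaranteed_conj {G : SGame} : Guaranteed (conj G) ↔ Guaranteed G :=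
  ⟨fun h => by simpa using h.conj, fun h => h.conj⟩

/-! ### Atoms and guaranteed games, position by position -/

theorem Guaranteed.of_isFollower {F G : SGame} (h : Guaranteed G) (hF : IsFollower F G) :
    Guaranteed F := fun F' hF' => h F' (hF'.trans hF)

theorem Guaranteed.of_isOption {F G : SGame} (h : Guaranteed G) (hF : IsOption F G) :
    Guaranteed F := h.of_isFollower (.single hF)

theorem HasAtom.of_isFollower {F G : SGame} {s : ℝ} (h : HasAtom F s) (hF : IsFollower F G) :
    HasAtom G s := by
  obtain ⟨F', hF', h⟩ := h
  exact ⟨F', hF'.trans hF, h⟩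

theorem hasAtom_of_left {G : SGame} {s : ℝ} (h : G.left = .atom s) : HasAtom G s :=
  ⟨G, .refl, .inl h⟩

theorem hasAtom_of_right {G : SGame} {s : ℝ} (h : G.right = .atom s) : HasAtom G s :=
  ⟨G, .refl, .inr h⟩

theorem hasAtom_iff {G : SGame} {s : ℝ} :
    HasAtom G s ↔ G.left = .atom s ∨ G.right = .atom s ∨ ∃ A, IsOption A G ∧ HasAtom A s := by
  constructor
  · rintro ⟨F, hF, h⟩
    rcases Relation.ReflTransGen.cases_tail hF with rfl | ⟨A, hA, hAG⟩
    · rcases h with h | h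
      · exact .inl h
      · exact .inr (.inl h)
    · exact .inr (.inr ⟨A, hAG, F, hA, h⟩)
  · rintro (h | h | ⟨A, hA, h⟩)
    · exact hasAtom_of_left h
    · exact hasAtom_of_right h
    · exact h.of_isFollower (.single hA)

theorem guaranteed_iff {G : SGame} : Guaranteed G ↔ (∀ A, IsOption A G → Guaranteed A) ∧
    (∀ l, G.left = .atom l → ∀ s, G.HasAtom s → l ≤ s) ∧
    (∀ r, G.right = .atom r → ∀ s, G.HasAtom s → s ≤ r) := by
  constructor
  · exact fun h => ⟨fun A hA => h.of_isOption hA, h G .refl⟩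
  · rintro ⟨h, h'⟩ F hF
    rcases Relation.ReflTransGen.cases_tail hF with rfl | ⟨A, hA, hAG⟩
    · exact h'
    · exact h A hAG F hA

/-- The atoms of a game are bounded. -/
theorem exists_hasAtom_bound (G : SGame) : ∃ M : ℝ, ∀ s, HasAtom G s → |s| ≤ M := by
  induction G using induction with
  | h G ih =>
  choose! f hf using ih
  obtain ⟨M, hM⟩ : ∃ M : ℝ, ∀ A ∈ G.leftOptions ∪ G.rightOptions, f A ≤ M := by
    obtain ⟨M, hM⟩ := ((G.leftOptions ∪ G.rightOptions).image f).bddAbove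
    exact ⟨M, fun A hA => hM (Finset.mem_coe.2 (Finset.mem_image_of_mem f hA))⟩
  have hside : ∀ a : Side SGame, ∃ N : ℝ, ∀ s, a = .atom s → |s| ≤ N := by
    rintro (s | ⟨S, hS⟩)
    · exact ⟨|s|, fun t h => by injection h with h; rw [h]⟩
    · exact ⟨0, fun t h => by simp at h⟩
  obtain ⟨N₁, h₁⟩ := hside G.left
  obtain ⟨N₂, h₂⟩ := hside G.right
  refine ⟨max M (max N₁ N₂), fun s hs => ?_⟩
  rcases hasAtom_iff.1 hs with h | h | ⟨A, hA, h⟩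
  · exact (h₁ s h).trans (by simp)
  · exact (h₂ s h).trans (by simp)
  · refine (hf A hA s h).trans ((hM A ?_).trans (by simp))
    exact Finset.mem_union.2 hA

/-! ### Stops -/

theorem Ls_of_atom {G : SGame} {s : ℝ} (h : G.left = .atom s) : Ls G = s := by
  rw [Ls]
  split
  · next t ht => rw [h] at ht; injection ht with ht; exact ht.symm
  · next S hS ht => rw [h] at ht; cases ht

theorem Rs_of_atom {G : SGame} {s : ℝ} (h : G.right = .atom s) : Rs G = s := by
  rw [Rs]
  split
  · next t ht => rw [h] at ht; injection ht with ht; exact ht.symm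
  · next S hS ht => rw [h] at ht; cases ht

theorem Rs_le_Ls {G A : SGame} (hA : A ∈ G.leftOptions) : Rs A ≤ Ls G := by
  rw [Ls]
  split
  · next t ht => exact absurd ht (left_ne_atom hA t)
  · next S hS ht =>
    have hAS : A ∈ S := by simpa [leftOptions, ht] using hA
    exact Finset.le_sup' (fun x : S => Rs x.1) (Finset.mem_attach S ⟨A, hAS⟩)

theorem exists_Ls_eq {G : SGame} (h : G.leftOptions.Nonempty) :
    ∃ A ∈ G.leftOptions, Ls G = Rs A := by
  rw [Ls]
  split
  · next t ht => simp [leftOptions_eq_empty ht] at h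
  · next S hS ht =>
    obtain ⟨x, -, hx⟩ := Finset.exists_mem_eq_sup' hS.attach (fun x : S => Rs x.1)
    exact ⟨x.1, by simp [leftOptions, ht], hx⟩

theorem Rs_eq_neg_Ls_conj_and (G : SGame) : Rs (conj G) = -Ls G ∧ Ls (conj G) = -Rs G := by
  induction G using induction with
  | h G ih =>
  constructor
  · rw [Rs]
    split
    · next t ht => rw [Ls_of_atom (right_conj_eq_atom.1 ht), neg_neg]
    · next S hS ht =>
      have hS' : ∀ A, conj A ∈ S ↔ A ∈ G.leftOptions := fun A => by
        rw [← conj_mem_rightOptions_conj, rightOptions, ht, Side.set_options]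
      apply le_antisymm
      · have hne : G.leftOptions.Nonempty := by
          obtain ⟨x, hx⟩ := hS
          exact ⟨conj x, by rw [← hS', conj_conj]; exact hx⟩
        obtain ⟨A, hA, h⟩ := exists_Ls_eq hne
        rw [h, ← (ih A (.inl hA)).2]
        exact Finset.inf'_le (fun x : S => Ls x.1) (Finset.mem_attach S ⟨conj A, (hS' A).2 hA⟩)
      · refine Finset.le_inf' _ _ fun x _ => ?_
        have hx : conj x.1 ∈ G.leftOptions := by
          rw [← hS', conj_conj]; exact x.2
        have h := (ih _ (.inl hx)).2
        rw [conj_conj] at h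
        rw [h]
        exact neg_le_neg (Rs_le_Ls hx)
  · rw [Rs]
    split
    · next t ht => exact Ls_of_atom (left_conj_eq_atom.2 (by rw [neg_neg]; exact ht))
    · next S hS ht =>
      have hS' : ∀ A, A ∈ S ↔ A ∈ G.rightOptions := fun A => by
        rw [rightOptions, ht, Side.set_options]
      apply le_antisymm
      · have hne : (conj G).leftOptions.Nonempty := by
          obtain ⟨x, hx⟩ := hS
          exact ⟨conj x, conj_mem_leftOptions_conj.2 ((hS' x).1 hx)⟩
        obtain ⟨A, hA, h⟩ := exists_Ls_eq hne
        rw [mem_leftOptions_conj] at hA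
        have h' := (ih _ (.inr hA)).1
        rw [conj_conj] at h'
        rw [h, h', neg_le_neg_iff]
        exact Finset.inf'_le (fun x : S => Ls x.1) (Finset.mem_attach S ⟨conj A, (hS' _).2 hA⟩)
      · rw [neg_le]
        refine Finset.le_inf' _ _ fun x _ => ?_
        have hx : x.1 ∈ G.rightOptions := (hS' _).1 x.2
        have h := Rs_le_Ls (conj_mem_leftOptions_conj.2 hx)
        rw [(ih _ (.inr hx)).1] at h
        linarith

theorem Rs_conj (G : SGame) : Rs (conj G) = -Ls G := (Rs_eq_neg_Ls_conj_and G).1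

theorem Ls_conj (G : SGame) : Ls (conj G) = -Rs G := (Rs_eq_neg_Ls_conj_and G).2

theorem Rs_le_Ls_of_mem_right {G A : SGame} (hA : A ∈ G.rightOptions) : Rs G ≤ Ls A := by
  have h := Rs_le_Ls (conj_mem_leftOptions_conj.2 hA)
  rw [Rs_conj, Ls_conj] at h
  linarith

theorem exists_Rs_eq {G : SGame} (h : G.rightOptions.Nonempty) :
    ∃ A ∈ G.rightOptions, Rs G = Ls A := by
  obtain ⟨A, hA, h'⟩ := exists_Ls_eq (G := conj G) (by rw [leftOptions_conj]; exact h.image _)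
  refine ⟨conj A, mem_leftOptions_conj.1 hA, ?_⟩
  rw [Ls_conj] at h' ⊢
  linarith

theorem rightOptions_nonempty_of_ne {G : SGame} (h : ∀ s, G.right ≠ .atom s) :
    G.rightOptions.Nonempty := by
  by_contra h'
  obtain ⟨s, hs⟩ := Side.set_eq_empty.1 (Finset.not_nonempty_iff_eq_empty.1 h')
  exact h s hs

/-- Case distinction behind every bound from above on a Left-stop. -/
theorem Ls_le {G : SGame} {c : ℝ} (h₁ : ∀ s, G.left = .atom s → s ≤ c)
    (h₂ : ∀ A ∈ G.leftOptions, Rs A ≤ c) : Ls G ≤ c := by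
  by_cases h : ∃ s, G.left = .atom s
  · obtain ⟨s, hs⟩ := h
    rw [Ls_of_atom hs]
    exact h₁ s hs
  · push Not at h
    obtain ⟨A, hA, h⟩ := exists_Ls_eq (leftOptions_nonempty_of_ne h)
    rw [h]
    exact h₂ A hA

/-- Case distinction behind every bound from below on a Right-stop. -/
theorem le_Rs {G : SGame} {c : ℝ} (h₁ : ∀ s, G.right = .atom s → c ≤ s)
    (h₂ : ∀ A ∈ G.rightOptions, c ≤ Ls A) : c ≤ Rs G := by
  by_cases h : ∃ s, G.right = .atom s
  · obtain ⟨s, hs⟩ := h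
    rw [Rs_of_atom hs]
    exact h₁ s hs
  · push Not at h
    obtain ⟨A, hA, h⟩ := exists_Rs_eq (rightOptions_nonempty_of_ne h)
    rw [h]
    exact h₂ A hA

/-- The stops are scores that occur in the game. -/
theorem hasAtom_stops (G : SGame) : HasAtom G (Ls G) ∧ HasAtom G (Rs G) := by
  induction G using induction with
  | h G ih =>
  constructor
  · by_cases h : ∃ s, G.left = .atom s
    · obtain ⟨s, hs⟩ := h
      rw [Ls_of_atom hs]
      exact hasAtom_of_left hs
    · push Not at h
      obtain ⟨A, hA, h⟩ := exists_Ls_eq (leftOptions_nonempty_of_ne h)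
      rw [h]
      exact (ih A (.inl hA)).2.of_isFollower (.single (.inl hA))
  · by_cases h : ∃ s, G.right = .atom s
    · obtain ⟨s, hs⟩ := h
      rw [Rs_of_atom hs]
      exact hasAtom_of_right hs
    · push Not at h
      obtain ⟨A, hA, h⟩ := exists_Rs_eq (rightOptions_nonempty_of_ne h)
      rw [h]
      exact (ih A (.inr hA)).1.of_isFollower (.single (.inr hA))

/-! ### Numbers and waiting moves -/

theorem left_number (c : ℝ) : (number c).left = .atom c := left_mk _ _

theorem right_number (c : ℝ) : (number c).right = .atom c := right_mk _ _

theorem conj_number (c : ℝ) : conj (number c) = number (-c) := by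
  apply ext_options
  · rw [leftOptions_conj, leftOptions_eq_empty (left_number _),
      rightOptions_eq_empty (right_number _), Finset.image_empty]
  · rw [rightOptions_conj, leftOptions_eq_empty (left_number _),
      rightOptions_eq_empty (right_number _), Finset.image_empty]
  · simp [left_conj_eq_atom, left_number, right_number, eq_neg_iff_add_eq_zero,
      neg_eq_iff_add_eq_zero]
  · simp [right_conj_eq_atom, left_number, right_number, eq_neg_iff_add_eq_zero,
      neg_eq_iff_add_eq_zero]

theorem leftOptions_add_number (G : SGame) (c : ℝ) :
    (G + number c).leftOptions = G.leftOptions.image (· + number c) := by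
  simp [leftOptions_add, leftOptions_eq_empty (left_number c)]

theorem left_add_number_eq_atom {G : SGame} {c u : ℝ} :
    (G + number c).left = .atom u ↔ G.left = .atom (u - c) := by
  rw [left_add_eq_atom]
  constructor
  · rintro ⟨s, t, hs, ht, rfl⟩
    rw [left_number] at ht
    injection ht with ht
    rw [hs, ht, add_sub_cancel_right]
  · exact fun h => ⟨_, c, h, left_number c, sub_add_cancel _ _⟩

/-- Adding a number shifts both stops. -/
theorem stops_add_number (G : SGame) (c : ℝ) :
    Ls (G + number c) = Ls G + c ∧ Rs (G + number c) = Rs G + c := by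
  induction G using induction generalizing c with
  | h G ih =>
  have key : ∀ (G : SGame) (c : ℝ), (∀ A ∈ G.leftOptions, Rs (A + number c) = Rs A + c) →
      Ls (G + number c) = Ls G + c := by
    intro G c ih
    apply le_antisymm
    · refine Ls_le (fun s hs => ?_) fun A hA => ?_
      · rw [Ls_of_atom (left_add_number_eq_atom.1 hs), sub_add_cancel]
      · rw [leftOptions_add_number, Finset.mem_image] at hA
        obtain ⟨A, hA, rfl⟩ := hA
        rw [ih A hA]
        exact add_le_add_left (Rs_le_Ls hA) c
    · rw [← le_sub_iff_add_le]
      refine Ls_le (fun s hs => ?_) fun A hA => ?_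
      · have hs' : (G + number c).left = .atom (s + c) :=
          left_add_number_eq_atom.2 (by rwa [add_sub_cancel_right])
        rw [Ls_of_atom hs', add_sub_cancel_right]
      · rw [le_sub_iff_add_le, ← ih A hA]
        apply Rs_le_Ls
        rw [leftOptions_add_number]
        exact Finset.mem_image_of_mem _ hA
  refine ⟨key G c fun A hA => (ih A (.inl hA) c).2, ?_⟩
  have := key (conj G) (-c) fun A hA => by
    rw [mem_leftOptions_conj] at hA
    have h := (ih _ (.inr hA) c).1
    rw [← conj_conj A, ← conj_number, ← conj_add, Rs_conj, Rs_conj, h]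
    ring
  rw [← conj_number, ← conj_add, Ls_conj, Ls_conj] at this
  linarith

theorem Ls_add_number (G : SGame) (c : ℝ) : Ls (G + number c) = Ls G + c :=
  (stops_add_number G c).1

theorem Rs_add_number (G : SGame) (c : ℝ) : Rs (G + number c) = Rs G + c :=
  (stops_add_number G c).2

theorem subWait_zero (G : SGame) : subWait G 0 = G := by
  have : conj (wait 0) = 0 := by
    rw [wait]
    change conj (number 0) = number 0
    rw [conj_number, neg_zero]
  rw [subWait, this, add_zero]

theorem left_conj_wait (n : ℕ) : (conj (wait n)).left = .atom 0 := by
  rw [left_conj_eq_atom, neg_zero]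
  cases n with
  | zero => exact right_zero
  | succ n => rw [wait]; simp

theorem rightOptions_conj_wait_succ (n : ℕ) :
    (conj (wait (n + 1))).rightOptions = {conj (wait n)} := by
  rw [rightOptions_conj, wait]
  simp

theorem left_subWait_eq_atom {G : SGame} {n : ℕ} {u : ℝ} :
    (subWait G n).left = .atom u ↔ G.left = .atom u := by
  rw [subWait, left_add_eq_atom]
  constructor
  · rintro ⟨s, t, hs, ht, rfl⟩
    rw [left_conj_wait] at ht
    injection ht with ht
    rw [← ht, add_zero, hs]
  · exact fun h => ⟨u, 0, h, left_conj_wait n, add_zero u⟩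

theorem leftOptions_subWait (G : SGame) (n : ℕ) :
    (subWait G n).leftOptions = G.leftOptions.image (subWait · n) := by
  simp [subWait, leftOptions_add, leftOptions_eq_empty (left_conj_wait n)]

theorem mem_rightOptions_subWait {G A : SGame} {n : ℕ} (hA : A ∈ G.rightOptions) :
    subWait A n ∈ (subWait G n).rightOptions := by
  rw [subWait, rightOptions_add, Finset.mem_union]
  exact .inl (Finset.mem_image_of_mem _ hA)

theorem rightOptions_subWait_succ (G : SGame) (n : ℕ) : (subWait G (n + 1)).rightOptions =
    insert (subWait G n) (G.rightOptions.image (subWait · (n + 1))) := by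
  rw [subWait, rightOptions_add, rightOptions_conj_wait_succ, Finset.union_comm,
    Finset.image_singleton]
  rfl

theorem subWait_number_succ (l : ℝ) (n : ℕ) : subWait (number l) (n + 1) =
    mk (.atom l) (.options {subWait (number l) n} (Finset.singleton_nonempty _)) := by
  apply ext_options
  · simp [leftOptions_subWait, leftOptions_eq_empty (left_number l)]
  · simp [rightOptions_subWait_succ, rightOptions_eq_empty (right_number l)]
  · simp [left_subWait_eq_atom, left_number]
  · intro s
    have h : subWait (number l) n ∈ (subWait (number l) (n + 1)).rightOptions := by
      simp [rightOptions_subWait_succ]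
    simp only [right_mk, reduceCtorEq, iff_false]
    intro h'
    simp [rightOptions_eq_empty h'] at h

theorem left_subWait_number (l : ℝ) (n : ℕ) : (subWait (number l) n).left = .atom l :=
  left_subWait_eq_atom.2 (left_number l)

theorem rightOptions_subWait_number_succ (l : ℝ) (n : ℕ) :
    (subWait (number l) (n + 1)).rightOptions = {subWait (number l) n} := by
  rw [subWait_number_succ, rightOptions_mk, Side.set_options]

theorem hasAtom_subWait_number {l s : ℝ} {n : ℕ} : HasAtom (subWait (number l) n) s ↔ s = l := by
  refine ⟨fun h => ?_, fun h => h.symm ▸ hasAtom_of_left (left_subWait_number l n)⟩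
  induction n with
  | zero =>
    rw [subWait_zero, hasAtom_iff] at h
    rcases h with h | h | ⟨A, hA, h⟩
    · rw [left_number] at h; injection h with h; exact h.symm
    · rw [right_number] at h; injection h with h; exact h.symm
    · simp [IsOption, leftOptions_eq_empty (left_number l),
        rightOptions_eq_empty (right_number l)] at hA
  | succ n ih =>
    rw [subWait_number_succ, hasAtom_iff] at h
    rcases h with h | h | ⟨A, hA, h⟩
    · rw [left_mk] at h; injection h with h; exact h.symm
    · simp at h
    · simp [IsOption] at hA
      subst hA
      exact ih h

theorem guaranteed_subWait_number (l : ℝ) (n : ℕ) : Guaranteed (subWait (number l) n) := by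
  have hloc : ∀ n, (∀ l', (subWait (number l) n).left = .atom l' →
      ∀ s, (subWait (number l) n).HasAtom s → l' ≤ s) ∧
      (∀ r, (subWait (number l) n).right = .atom r →
      ∀ s, (subWait (number l) n).HasAtom s → s ≤ r) := by
    intro n
    constructor
    · intro l' hl' s hs
      rw [hasAtom_subWait_number.1 hs, hasAtom_subWait_number.1 (hasAtom_of_left hl')]
    · intro l' hl' s hs
      rw [hasAtom_subWait_number.1 hs, hasAtom_subWait_number.1 (hasAtom_of_right hl')]
  induction n with
  | zero =>
    refine guaranteed_iff.2 ⟨fun A hA => ?_, hloc 0⟩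
    rw [subWait_zero] at hA
    simp [IsOption, leftOptions_eq_empty (left_number l),
        rightOptions_eq_empty (right_number l)] at hA
  | succ n ih =>
    refine guaranteed_iff.2 ⟨fun A hA => ?_, hloc (n + 1)⟩
    simp only [IsOption, leftOptions_eq_empty (left_subWait_number l _),
      rightOptions_subWait_number_succ, Finset.notMem_empty, Finset.mem_singleton, false_or] at hA
    exact hA ▸ ih

theorem guaranteed_number (c : ℝ) : Guaranteed (number c) := by
  rw [← subWait_zero (number c)]
  exact guaranteed_subWait_number c 0

theorem conj_wait_eq (n : ℕ) : conj (wait n) = subWait (number 0) n :=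
  (zero_add (conj (wait n))).symm

theorem guaranteed_conj_wait (n : ℕ) : Guaranteed (conj (wait n)) := by
  rw [conj_wait_eq]
  exact guaranteed_subWait_number 0 n

/-! ### A weight of game trees -/

/-- The delayed numbers `l - n̂` and their conjugates. -/
def IsDelayedNumber (G : SGame) : Prop :=
  ∃ l n, G = subWait (number l) n ∨ G = conj (subWait (number l) n)

/-- The weight of a game: the number of nodes of its tree, where a node counts once if the game
rooted there is a delayed number, and twice otherwise. Weights bound the number of moves, and
every reduction that replaces an option by a different delayed number lowers the weight. -/
noncomputable def weight (G : SGame) : ℕ :=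
  (if IsDelayedNumber G then 1 else 2) + ∑ x ∈ G.left.set.attach, weight x.1 +
    ∑ x ∈ G.right.set.attach, weight x.1
termination_by G
decreasing_by
  · exact isOption_left x.2
  · exact isOption_right x.2

theorem weight_eq (G : SGame) : weight G = (if IsDelayedNumber G then 1 else 2) +
    ∑ A ∈ G.leftOptions, weight A + ∑ A ∈ G.rightOptions, weight A := by
  rw [weight, Finset.sum_attach G.left.set weight, Finset.sum_attach G.right.set weight]
  rfl

theorem weight_pos (G : SGame) : 1 ≤ weight G := by
  rw [weight_eq]
  split <;> omega

theorem weight_lt_of_isOption {A G : SGame} (h : IsOption A G) : weight A < weight G := by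
  rw [weight_eq G]
  have h₁ : 1 ≤ if IsDelayedNumber G then 1 else 2 := by split <;> omega
  rcases h with h | h
  · have := Finset.single_le_sum (f := weight) (fun _ _ => Nat.zero_le _) h
    omega
  · have := Finset.single_le_sum (f := weight) (fun _ _ => Nat.zero_le _) h
    omega

theorem isDelayedNumber_conj {G : SGame} : IsDelayedNumber (conj G) ↔ IsDelayedNumber G := by
  have key : ∀ G, IsDelayedNumber G → IsDelayedNumber (conj G) := by
    rintro G ⟨l, n, rfl | rfl⟩
    · exact ⟨l, n, .inr rfl⟩
    · exact ⟨l, n, .inl (conj_conj _)⟩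
  exact ⟨fun h => by simpa using key _ h, key G⟩

theorem weight_conj (G : SGame) : weight (conj G) = weight G := by
  induction G using induction with
  | h G ih =>
  rw [weight_eq, weight_eq G, isDelayedNumber_conj, leftOptions_conj, rightOptions_conj,
    Finset.sum_image (fun _ _ _ _ h => conj_injective h),
    Finset.sum_image (fun _ _ _ _ h => conj_injective h),
    Finset.sum_congr rfl fun x hx => ih x (.inl hx),
    Finset.sum_congr rfl fun x hx => ih x (.inr hx)]
  exact add_right_comm _ _ _

theorem weight_subWait_number (l : ℝ) (n : ℕ) : weight (subWait (number l) n) = n + 1 := by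
  have h : ∀ n, IsDelayedNumber (subWait (number l) n) := fun n => ⟨l, n, .inl rfl⟩
  induction n with
  | zero =>
    have h₀ := h 0
    rw [subWait_zero] at h₀ ⊢
    rw [weight_eq, if_pos h₀, leftOptions_eq_empty (left_number l),
      rightOptions_eq_empty (right_number l), Finset.sum_empty]
    rfl
  | succ n ih =>
    rw [weight_eq, if_pos (h _), leftOptions_eq_empty (left_subWait_number l _),
      rightOptions_subWait_number_succ, Finset.sum_empty, Finset.sum_singleton, ih]
    omega

/-! ### Pass-allowed stops -/

theorem hasAtom_subWait {G : SGame} {n : ℕ} {s : ℝ} (h : HasAtom (subWait G n) s) :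
    HasAtom G s := by
  obtain ⟨a, b, ha, hb, rfl⟩ := hasAtom_add h
  rw [conj_wait_eq, hasAtom_subWait_number] at hb
  rwa [hb, add_zero]

/-- If all scores of `X` are at least `x` and `X` cannot last for more than `n` moves, then in
`G + X` Left achieves what she achieves in `G - n̂`, plus `x`: she plays in `G` as if Right's
moves in `X` were passes, and once she has no move left in `G`, no score of `G` is below the
one she is guaranteed. -/
theorem stops_subWait_add_le {x : ℝ} (G : SGame) (hG : Guaranteed G) (X : SGame) (n : ℕ)
    (hX : ∀ s, HasAtom X s → x ≤ s) (hn : weight X ≤ n + 1) :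
    Ls (subWait G n) + x ≤ Ls (G + X) ∧ Rs (subWait G n) + x ≤ Rs (G + X) := by
  induction G using induction generalizing X n with
  | h G ihG =>
  induction X using induction generalizing n with
  | h X ihX =>
  constructor
  · rw [← le_sub_iff_add_le]
    refine Ls_le (fun s hs => ?_) fun A hA => ?_
    · obtain ⟨a, b, ha, hb, hab⟩ := hasAtom_add (hasAtom_stops (G + X)).1
      have h₁ := (hG G .refl).1 s (left_subWait_eq_atom.1 hs) a ha
      have h₂ := hX b hb
      linarith
    · rw [leftOptions_subWait, Finset.mem_image] at hA
      obtain ⟨A, hA, rfl⟩ := hA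
      have h₁ := (ihG A (.inl hA) (hG.of_isOption (.inl hA)) X n hX hn).2
      have h₂ : Rs (A + X) ≤ Ls (G + X) := Rs_le_Ls (by
        rw [leftOptions_add, Finset.mem_union]
        exact .inl (Finset.mem_image_of_mem _ hA))
      linarith
  · refine le_Rs (fun s hs => ?_) fun A hA => ?_
    · obtain ⟨a, b, ha, hb, rfl⟩ := (right_add_eq_atom _ _ _).1 hs
      exact add_le_add ((hG G .refl).2 a ha _ (hasAtom_subWait (hasAtom_stops _).2))
        (hX b (hasAtom_of_right hb))
    · rw [rightOptions_add, Finset.mem_union, Finset.mem_image, Finset.mem_image] at hA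
      rcases hA with ⟨A, hA, rfl⟩ | ⟨A, hA, rfl⟩
      · have h₁ := (ihG A (.inr hA) (hG.of_isOption (.inr hA)) X n hX hn).1
        have h₂ := Rs_le_Ls_of_mem_right (mem_rightOptions_subWait (n := n) hA)
        linarith
      · have hlt := weight_lt_of_isOption (.inr hA)
        have hpos := weight_pos A
        obtain ⟨m, rfl⟩ : ∃ m, n = m + 1 := ⟨n - 1, by omega⟩
        have h₁ := (ihX A (.inr hA) m (fun s hs => hX s (hs.of_isFollower (.single (.inr hA))))
          (by omega)).1
        have h₂ : Rs (subWait G (m + 1)) ≤ Ls (subWait G m) :=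
          Rs_le_Ls_of_mem_right (by simp [rightOptions_subWait_succ])
        linarith

theorem stops_subWait_antitone {G : SGame} (hG : Guaranteed G) {m n : ℕ} (h : m ≤ n) :
    Ls (subWait G n) ≤ Ls (subWait G m) ∧ Rs (subWait G n) ≤ Rs (subWait G m) := by
  have := stops_subWait_add_le (x := 0) G hG (conj (wait m)) n
    (fun s hs => by
      rw [conj_wait_eq, hasAtom_subWait_number] at hs
      exact hs.ge)
    (by rw [conj_wait_eq, weight_subWait_number]; omega)
  simpa [subWait] using this

theorem bddBelow_stops_subWait (G : SGame) :
    BddBelow (Set.range fun n => Ls (subWait G n)) ∧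
      BddBelow (Set.range fun n => Rs (subWait G n)) := by
  obtain ⟨M, hM⟩ := exists_hasAtom_bound G
  constructor
  · refine ⟨-M, ?_⟩
    rintro _ ⟨n, rfl⟩
    exact (abs_le.1 (hM _ (hasAtom_subWait (hasAtom_stops _).1))).1
  · refine ⟨-M, ?_⟩
    rintro _ ⟨n, rfl⟩
    exact (abs_le.1 (hM _ (hasAtom_subWait (hasAtom_stops _).2))).1

theorem passLs_le (G : SGame) (n : ℕ) : passLs G ≤ Ls (subWait G n) :=
  ciInf_le (bddBelow_stops_subWait G).1 n

theorem passRs_le (G : SGame) (n : ℕ) : passRs G ≤ Rs (subWait G n) :=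
  ciInf_le (bddBelow_stops_subWait G).2 n

theorem passLs_of_left_atom {G : SGame} {l : ℝ} (h : G.left = .atom l) : passLs G = l := by
  have : ∀ n, Ls (subWait G n) = l := fun n => Ls_of_atom (left_subWait_eq_atom.2 h)
  simp [passLs, this]

theorem passRs_le_passLs {G A : SGame} (hA : A ∈ G.leftOptions) : passRs A ≤ passLs G :=
  le_ciInf fun n => (passRs_le A n).trans (Rs_le_Ls (by
    rw [leftOptions_subWait]
    exact Finset.mem_image_of_mem _ hA))

/-- Some Left option of `G` achieves the pass-allowed Left-stop of `G`: the stops of `G - n̂`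
decrease with `n`, so one `n` can serve for all options. -/
theorem exists_passLs_eq {G : SGame} (hG : Guaranteed G) (h : G.leftOptions.Nonempty) :
    ∃ A ∈ G.leftOptions, passLs G = passRs A := by
  by_contra! hne
  have hlt : ∀ A ∈ G.leftOptions, ∃ n, Rs (subWait A n) < passLs G := fun A hA =>
    exists_lt_of_ciInf_lt ((passRs_le_passLs hA).lt_of_ne (hne A hA).symm)
  choose! f hf using hlt
  obtain ⟨N, hN⟩ := (G.leftOptions.image f).bddAbove
  obtain ⟨A, hA, h'⟩ := exists_Ls_eq (G := subWait G N) (by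
    rw [leftOptions_subWait]; exact h.image _)
  rw [leftOptions_subWait, Finset.mem_image] at hA
  obtain ⟨A, hA, rfl⟩ := hA
  have h₁ := (stops_subWait_antitone (hG.of_isOption (.inl hA))
    (hN (Finset.mem_coe.2 (Finset.mem_image_of_mem f hA)))).2
  have h₂ := hf A hA
  have h₃ := passLs_le G N
  linarith

/-- If Left has no move in `A`, and Right can only move to positions where Left has no move
either and the score is the same, then this score is Right's pass-allowed Right-stop. -/
theorem passRs_eq_of_atomic {A : SGame} {l : ℝ} (hA : A.left = .atom l)
    (hne : A.rightOptions.Nonempty) (h : ∀ B ∈ A.rightOptions, B.left = .atom l) :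
    passRs A = l := by
  apply le_antisymm
  · obtain ⟨B, hB⟩ := hne
    refine (passRs_le A 0).trans ?_
    rw [subWait_zero, ← Ls_of_atom (h B hB)]
    exact Rs_le_Ls_of_mem_right hB
  · refine le_ciInf fun n => le_Rs (fun s hs => ?_) fun C hC => ?_
    · obtain ⟨a, b, ha, -⟩ := (right_add_eq_atom _ _ _).1 hs
      simp [rightOptions_eq_empty ha] at hne
    · have key : ∀ n, ∀ C ∈ A.rightOptions.image (subWait · n), l ≤ Ls C := by
        intro n C hC
        obtain ⟨B, hB, rfl⟩ := Finset.mem_image.1 hC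
        rw [Ls_of_atom (left_subWait_eq_atom.2 (h B hB))]
      cases n with
      | zero =>
        rw [subWait_zero] at hC
        rw [Ls_of_atom (h C hC)]
      | succ n =>
        rw [rightOptions_subWait_succ, Finset.mem_insert] at hC
        rcases hC with rfl | hC
        · rw [Ls_of_atom (left_subWait_eq_atom.2 hA)]
        · exact key _ C hC

/-! ### Comparison of games -/

theorem Succeq.refl (G : SGame) : Succeq G G := fun _ _ => ⟨le_rfl, le_rfl⟩

theorem Succeq.trans {G H K : SGame} (h : Succeq G H) (h' : Succeq H K) : Succeq G K :=
  fun X hX => ⟨(h' X hX).1.trans (h X hX).1, (h' X hX).2.trans (h X hX).2⟩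

theorem Equivalent.refl (G : SGame) : Equivalent G G := ⟨.refl G, .refl G⟩

theorem Equivalent.symm {G H : SGame} (h : Equivalent G H) : Equivalent H G := ⟨h.2, h.1⟩

theorem Equivalent.trans {G H K : SGame} (h : Equivalent G H) (h' : Equivalent H K) :
    Equivalent G K := ⟨h.1.trans h'.1, h'.2.trans h.2⟩

theorem succeq_conj {G H : SGame} : Succeq (conj G) (conj H) ↔ Succeq H G := by
  have key : ∀ {G H : SGame}, Succeq H G → Succeq (conj G) (conj H) := by
    intro G H h X hX
    have := h (conj X) hX.conj
    rw [← conj_conj X, ← conj_add, ← conj_add, Ls_conj, Ls_conj, Rs_conj, Rs_conj,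
      neg_le_neg_iff, neg_le_neg_iff]
    exact this.symm
  exact ⟨fun h => by simpa using key h, key⟩

theorem equivalent_conj {G H : SGame} : Equivalent (conj G) (conj H) ↔ Equivalent G H := by
  rw [Equivalent, succeq_conj, succeq_conj, and_comm, Equivalent, and_comm]

theorem Succeq.passLs_le {G H : SGame} (h : Succeq G H) : passLs H ≤ passLs G :=
  le_ciInf fun n => (SGame.passLs_le H n).trans (h _ (guaranteed_conj_wait n)).1

/-- The conditions of the comparison `G ≽ H` that concern Left's side of `H`: if Left has no
move in `H`, then she does as well in `G`, even if Right may pass; every other Left option of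
`H` is matched by a Left option of `G` or is reversed by `G`. -/
def LeftCovers (G H : SGame) : Prop :=
  (∀ h, H.left = .atom h → h ≤ passLs G) ∧
    ∀ A ∈ H.leftOptions, (∃ C ∈ G.leftOptions, Succeq C A) ∨ ∃ B ∈ A.rightOptions, Succeq G B

theorem LeftCovers.refl (G : SGame) : LeftCovers G G :=
  ⟨fun _ h => (passLs_of_left_atom h).ge, fun A hA => .inl ⟨A, hA, .refl A⟩⟩

theorem LeftCovers.congr_right {G H H' : SGame} (h : LeftCovers G H) (hl : H'.left = H.left) :
    LeftCovers G H' := by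
  rw [LeftCovers, leftOptions, hl]
  exact h

theorem left_conj_congr {G G' : SGame} (h : G.right = G'.right) :
    (conj G).left = (conj G').left := by
  rw [Side.ext_iff']
  refine ⟨?_, fun s => by rw [left_conj_eq_atom, left_conj_eq_atom, h]⟩
  change (conj G).leftOptions = (conj G').leftOptions
  rw [leftOptions_conj, leftOptions_conj, rightOptions, rightOptions, h]

/-- If Left has no move in `X`, she does at least as well in `G + X` as her pass-allowed stop. -/
theorem passLs_add_le {G X : SGame} {x : ℝ} (hG : Guaranteed G) (hX : Guaranteed X)
    (hx : X.left = .atom x) : passLs G + x ≤ Ls (G + X) := by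
  have h := (stops_subWait_add_le G hG X (weight X) ((hX X .refl).1 x hx) (by omega)).1
  have h' := passLs_le G (weight X)
  linarith

theorem LeftCovers.Ls_le {G H X : SGame} (h : LeftCovers G H) (hG : Guaranteed G)
    (hX : Guaranteed X) (ih : ∀ Y ∈ X.leftOptions, Rs (H + Y) ≤ Rs (G + Y)) :
    Ls (H + X) ≤ Ls (G + X) := by
  refine SGame.Ls_le (fun s hs => ?_) fun A hA => ?_
  · obtain ⟨a, b, ha, hb, rfl⟩ := (left_add_eq_atom _ _ _).1 hs
    have h₁ := h.1 a ha
    have h₂ := passLs_add_le hG hX hb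
    linarith
  · rw [leftOptions_add, Finset.mem_union, Finset.mem_image, Finset.mem_image] at hA
    rcases hA with ⟨A, hA, rfl⟩ | ⟨Y, hY, rfl⟩
    · rcases h.2 A hA with ⟨C, hC, hCA⟩ | ⟨B, hB, hGB⟩
      · refine (hCA X hX).2.trans (Rs_le_Ls ?_)
        rw [leftOptions_add, Finset.mem_union]
        exact .inl (Finset.mem_image_of_mem _ hC)
      · refine (Rs_le_Ls_of_mem_right (A := B + X) ?_).trans (hGB X hX).1
        rw [rightOptions_add, Finset.mem_union]
        exact .inl (Finset.mem_image_of_mem _ hB)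
    · refine (ih Y hY).trans (Rs_le_Ls ?_)
      rw [leftOptions_add, Finset.mem_union]
      exact .inr (Finset.mem_image_of_mem _ hY)

/-- The constructive comparison of guaranteed games: the conditions on Left's side of `H` and, by
conjugation, on Right's side of `G` imply `G ≽ H`. -/
theorem succeq_of_leftCovers {G H : SGame} (hG : Guaranteed G) (hH : Guaranteed H)
    (h : LeftCovers G H) (h' : LeftCovers (conj H) (conj G)) : Succeq G H := by
  intro X hX
  induction X using induction with
  | h X ih =>
  refine ⟨h.Ls_le hG hX fun Y hY => (ih Y (.inl hY) (hX.of_isOption (.inl hY))).2, ?_⟩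
  have := h'.Ls_le (X := conj X) hH.conj hX.conj fun Y hY => by
    rw [mem_leftOptions_conj] at hY
    have := (ih _ (.inr hY) (hX.of_isOption (.inr hY))).1
    rw [← conj_conj Y, ← conj_add, ← conj_add, Rs_conj, Rs_conj]
    exact neg_le_neg this
  rw [← conj_add, ← conj_add, Ls_conj, Ls_conj] at this
  exact neg_le_neg_iff.1 this

theorem guaranteed_mk_options {S T : Finset SGame} (hS : S.Nonempty) (hT : T.Nonempty)
    (h₁ : ∀ A ∈ S, Guaranteed A) (h₂ : ∀ A ∈ T, Guaranteed A) :
    Guaranteed (mk (.options S hS) (.options T hT)) := by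
  refine guaranteed_iff.2 ⟨?_, by simp, by simp⟩
  rintro A (hA | hA)
  · exact h₁ A (by simpa using hA)
  · exact h₂ A (by simpa using hA)

/-- A number so low that adding it makes all stops of the followers of `G` negative. -/
theorem exists_stops_add_number_neg (G : SGame) :
    ∃ c, ∀ F, IsFollower F G → Ls (F + number c) < 0 ∧ Rs (F + number c) < 0 := by
  obtain ⟨M, hM⟩ := exists_hasAtom_bound G
  refine ⟨-(M + 1), fun F hF => ?_⟩
  have h₁ := (abs_le.1 (hM _ ((hasAtom_stops F).1.of_isFollower hF))).2
  have h₂ := (abs_le.1 (hM _ ((hasAtom_stops F).2.of_isFollower hF))).2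
  rw [Ls_add_number, Rs_add_number]
  constructor <;> linarith

/-- If `G ≽ H` fails, a game witnesses this by Left-stops. A game `X` that witnesses it by
Right-stops is turned into one by giving Left the move to `X` and Right a very good move. -/
theorem exists_Ls_neg_of_not_succeq {G H : SGame} (h : ¬ Succeq G H) :
    ∃ X, Guaranteed X ∧ Ls (G + X) < 0 ∧ 0 < Ls (H + X) := by
  simp only [Succeq, not_forall, not_and_or, not_le] at h
  obtain ⟨X, hX, h | h⟩ := h
  · obtain ⟨c, hc₁, hc₂⟩ := exists_between h
    refine ⟨X + number (-c), hX.add (guaranteed_number _), ?_, ?_⟩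
    · rw [← add_assoc, Ls_add_number]; linarith
    · rw [← add_assoc, Ls_add_number]; linarith
  · obtain ⟨c, hc₁, hc₂⟩ := exists_between h
    obtain ⟨d, hd⟩ := exists_stops_add_number_neg G
    set Y := X + number (-c) with hYdef
    have hY : Guaranteed Y := hX.add (guaranteed_number _)
    have hY₁ : Rs (G + Y) < 0 := by rw [hYdef, ← add_assoc, Rs_add_number]; linarith
    have hY₂ : 0 < Rs (H + Y) := by rw [hYdef, ← add_assoc, Rs_add_number]; linarith
    set T := mk (.options {Y} (Finset.singleton_nonempty _))
      (.options {number d} (Finset.singleton_nonempty _)) with hT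
    refine ⟨T, ?_, ?_, ?_⟩
    · apply guaranteed_mk_options
      · simpa using hY
      · simpa using guaranteed_number d
    · have hne : (G + T).leftOptions.Nonempty := ⟨G + Y, by simp [leftOptions_add, hT]⟩
      obtain ⟨A, hA, hLs⟩ := exists_Ls_eq hne
      rw [hLs]
      simp only [leftOptions_add, hT, leftOptions_mk, Side.set_options, Finset.mem_union,
        Finset.mem_image, Finset.mem_singleton, exists_eq_left] at hA
      rcases hA with ⟨A, hA, rfl⟩ | rfl
      · refine lt_of_le_of_lt (Rs_le_Ls_of_mem_right (A := A + number d) ?_)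
          (hd A (.single (.inl hA))).1
        simp [rightOptions_add]
      · exact hY₁
    · exact hY₂.trans_le (Rs_le_Ls (by simp [leftOptions_add, hT]))

theorem exists_Rs_neg_of_not_succeq {G H : SGame} (h : ¬ Succeq G H) :
    ∃ X, Guaranteed X ∧ Rs (G + X) < 0 ∧ 0 < Rs (H + X) := by
  rw [← succeq_conj] at h
  obtain ⟨X, hX, h₁, h₂⟩ := exists_Ls_neg_of_not_succeq h
  rw [← conj_conj X, ← conj_add, Ls_conj] at h₁ h₂
  exact ⟨conj X, hX.conj, by linarith, by linarith⟩

/-- If no Left option of `G` is at least `H`, and `G` is at least no Right option of `H`, then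
some game links `G` to `H`: the player to move loses both sums. Its options are the games that
witness these failures, and for each player one move that is useless but keeps the player from
having no move. -/
theorem exists_link {G H : SGame} (h₁ : ∀ A ∈ G.leftOptions, ¬ Succeq A H)
    (h₂ : ∀ B ∈ H.rightOptions, ¬ Succeq G B) :
    ∃ T, Guaranteed T ∧ Ls (G + T) < 0 ∧ 0 < Rs (H + T) := by
  have hX := fun A hA => exists_Ls_neg_of_not_succeq (h₁ A hA)
  have hY := fun B hB => exists_Rs_neg_of_not_succeq (h₂ B hB)
  choose! X hX hX₁ hX₂ using hX
  choose! Y hY hY₁ hY₂ using hY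
  obtain ⟨c, hc⟩ := exists_stops_add_number_neg G
  obtain ⟨d, hd⟩ := exists_stops_add_number_neg (conj H)
  set T := mk (.options (insert (number c) (H.rightOptions.image Y)) (Finset.insert_nonempty _ _))
    (.options (insert (number (-d)) (G.leftOptions.image X)) (Finset.insert_nonempty _ _)) with hT
  refine ⟨T, ?_, ?_, ?_⟩
  · apply guaranteed_mk_options
    · intro A hA
      rw [Finset.mem_insert, Finset.mem_image] at hA
      rcases hA with rfl | ⟨B, hB, rfl⟩
      · exact guaranteed_number c
      · exact hY B hB
    · intro A hA
      rw [Finset.mem_insert, Finset.mem_image] at hA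
      rcases hA with rfl | ⟨B, hB, rfl⟩
      · exact guaranteed_number _
      · exact hX B hB
  · have hne : (G + T).leftOptions.Nonempty := ⟨G + number c, by simp [leftOptions_add, hT]⟩
    obtain ⟨A, hA, hLs⟩ := exists_Ls_eq hne
    rw [hLs]
    simp only [leftOptions_add, hT, leftOptions_mk, Side.set_options, Finset.mem_union,
      Finset.mem_image, Finset.mem_insert] at hA
    rcases hA with ⟨A, hA, rfl⟩ | ⟨_, rfl | ⟨B, hB, rfl⟩, rfl⟩
    · refine lt_of_le_of_lt (Rs_le_Ls_of_mem_right (A := A + X A) ?_) (hX₁ A hA)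
      simp only [rightOptions_add, rightOptions_mk, Side.set_options, Finset.mem_union,
        Finset.mem_image, Finset.mem_insert]
      exact .inr ⟨_, .inr ⟨A, hA, rfl⟩, rfl⟩
    · exact (hc G .refl).2
    · exact hY₁ B hB
  · have hne : (H + T).rightOptions.Nonempty :=
      ⟨H + number (-d), by simp [rightOptions_add, hT]⟩
    obtain ⟨A, hA, hRs⟩ := exists_Rs_eq hne
    rw [hRs]
    simp only [rightOptions_add, hT, rightOptions_mk, Side.set_options, Finset.mem_union,
      Finset.mem_image, Finset.mem_insert] at hA
    rcases hA with ⟨B, hB, rfl⟩ | ⟨_, rfl | ⟨A, hA, rfl⟩, rfl⟩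
    · refine (hY₂ B hB).trans_le (Rs_le_Ls (G := B + T) (A := B + Y B) ?_)
      simp only [hT, leftOptions_add, leftOptions_mk, Side.set_options, Finset.mem_union,
        Finset.mem_image, Finset.mem_insert]
      exact .inr ⟨_, .inr ⟨B, hB, rfl⟩, rfl⟩
    · have := (hd (conj H) .refl).2
      rw [← neg_neg d, ← conj_number, ← conj_add, Rs_conj] at this
      linarith
    · exact hX₂ A hA

/-- Conversely, both covering conditions are necessary for `G ≽ H`: were a Left option `A` of `H`
neither matched nor reversed, a link of `G` to `A` would separate `G` from `H`. -/
theorem Succeq.leftCovers {G H : SGame} (h : Succeq G H) : LeftCovers G H := by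
  refine ⟨fun a ha => (passLs_of_left_atom ha).ge.trans h.passLs_le, fun A hA => ?_⟩
  by_contra! hcon
  obtain ⟨T, hT, h₁, h₂⟩ := exists_link hcon.1 hcon.2
  have h₃ : Rs (A + T) ≤ Ls (H + T) := Rs_le_Ls (by
    rw [leftOptions_add, Finset.mem_union]
    exact .inl (Finset.mem_image_of_mem _ hA))
  have h₄ := (h T hT).1
  linarith

/-- A guaranteed game without Left moves is at least its Left score with enough waiting moves
for Right. -/
theorem exists_succeq_subWait_number {B : SGame} {l : ℝ} (hB : Guaranteed B)
    (hl : B.left = .atom l) : ∃ n, n + 1 ≤ weight B ∧ Succeq B (subWait (number l) n) := by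
  obtain ⟨n, hn⟩ : ∃ n, weight B = n + 1 := ⟨weight B - 1, by have := weight_pos B; omega⟩
  refine ⟨n, hn.ge, fun X hX => ?_⟩
  have h := stops_subWait_add_le X hX B n ((hB B .refl).1 l hl) hn.le
  have e : subWait (number l) n + X = subWait X n + number l := by
    rw [subWait, subWait, add_comm (number l), add_right_comm, add_comm (conj _)]
  rw [e, Ls_add_number, Rs_add_number, add_comm B]
  exact h

/-! ### Reductions preserve the game up to equivalence -/

theorem Guaranteed.replace_left {G : SGame} (hG : Guaranteed G) {S : Finset SGame}
    (hS : S.Nonempty) (h : ∀ A ∈ S, Guaranteed A ∧ ∀ s, HasAtom A s → HasAtom G s) :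
    Guaranteed (mk (.options S hS) G.right) ∧
      ∀ s, HasAtom (mk (.options S hS) G.right) s → HasAtom G s := by
  have hatom : ∀ s, HasAtom (mk (.options S hS) G.right) s → HasAtom G s := by
    intro s hs
    rcases hasAtom_iff.1 hs with h' | h' | ⟨A, hA | hA, h'⟩
    · simp at h'
    · exact hasAtom_of_right (by simpa using h')
    · exact (h A (by simpa using hA)).2 s h'
    · exact h'.of_isFollower (.single (.inr (by simpa [rightOptions] using hA)))
  refine ⟨guaranteed_iff.2 ⟨?_, by simp, fun r hr s hs => ?_⟩, hatom⟩
  · rintro A (hA | hA)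
    · exact (h A (by simpa using hA)).1
    · exact hG.of_isOption (.inr (by simpa [rightOptions] using hA))
  · exact (hG G .refl).2 r (by simpa using hr) s (hatom s hs)

theorem Guaranteed.of_mem_left {G A : SGame} (hG : Guaranteed G) (hA : A ∈ G.leftOptions) :
    Guaranteed A ∧ ∀ s, HasAtom A s → HasAtom G s :=
  ⟨hG.of_isOption (.inl hA), fun _ h => h.of_isFollower (.single (.inl hA))⟩

theorem LeftReversible.isFollower {G A B : SGame} (h : LeftReversible G A B) : IsFollower B G :=
  .head (.inr h.2.1) (.single (.inl h.1))

/-- Games with equal right sides and Left sides that cover each other are equivalent. -/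
theorem equivalent_of_leftCovers {G H : SGame} (hG : Guaranteed G) (hH : Guaranteed H)
    (hr : H.right = G.right) (h₁ : LeftCovers G H) (h₂ : LeftCovers H G) : Equivalent G H :=
  ⟨succeq_of_leftCovers hG hH h₁ ((LeftCovers.refl _).congr_right (left_conj_congr hr.symm)),
    succeq_of_leftCovers hH hG h₂ ((LeftCovers.refl _).congr_right (left_conj_congr hr))⟩

/-- The common part of the soundness of all reductions of an option `A` that is reversible
through `B`: if the new game is still good enough to cover the Left side of `B`, then it is at
least `B`, so that the loss of `A` does no harm. -/
theorem LeftReversible.equivalent {G H A B : SGame} (h : LeftReversible G A B)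
    (hG : Guaranteed G) (hH : Guaranteed H) (hr : H.right = G.right) (h₁ : LeftCovers H B)
    (h₂ : LeftCovers G H) (h₃ : ∀ C ∈ G.leftOptions, C ≠ A → C ∈ H.leftOptions) :
    Equivalent G H := by
  have hB : Succeq H B := succeq_of_leftCovers hH (hG.of_isFollower h.isFollower) h₁
    ((succeq_conj.2 h.2.2).leftCovers.congr_right (left_conj_congr hr))
  refine equivalent_of_leftCovers hG hH hr h₂ ⟨fun a ha => absurd ha (left_ne_atom h.1 a), ?_⟩
  intro C hC
  by_cases hCA : C = A
  · subst hCA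
    exact .inr ⟨B, h.2.1, hB⟩
  · exact .inl ⟨C, h₃ C hC hCA, .refl C⟩

theorem leftCovers_of_left_atom {G H : SGame} {l : ℝ} (hl : H.left = .atom l)
    (h : l ≤ passLs G) : LeftCovers G H := by
  refine ⟨fun a ha => ?_, fun A hA => absurd hl (left_ne_atom hA l)⟩
  rw [hl] at ha
  injection ha with ha
  exact ha ▸ h

/-- A reduction for Left turns a guaranteed game into an equivalent guaranteed game and creates
no new atoms. The last fact keeps the surrounding games guaranteed, too. -/
theorem LeftReduction.sound {G H : SGame} (h : LeftReduction G H) (hG : Guaranteed G) :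
    (Guaranteed H ∧ ∀ s, HasAtom H s → HasAtom G s) ∧ Equivalent G H := by
  cases h with
  | @dominated A B hA hB hne h hS =>
    have hH := hG.replace_left hS fun C hC => hG.of_mem_left (Finset.mem_of_mem_erase hC)
    refine ⟨hH, equivalent_of_leftCovers hG hH.1 (by simp) ⟨by simp, fun C hC => ?_⟩
      ⟨fun a ha => absurd ha (left_ne_atom hA a), fun C hC => .inl ?_⟩⟩
    · simp only [leftOptions_mk, Side.set_options, Finset.mem_erase] at hC
      exact .inl ⟨C, hC.2, .refl C⟩
    · by_cases hCA : C = A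
      · exact ⟨B, by simp [hB, hne.symm], hCA ▸ h⟩
      · exact ⟨C, by simp [hC, hCA], .refl C⟩
  | @bypass A B h hB hS =>
    have hH := hG.replace_left hS fun C hC => by
      rcases Finset.mem_union.1 hC with hC | hC
      · exact hG.of_mem_left (Finset.mem_of_mem_erase hC)
      · have hf : IsFollower C G := .head (.inl hC) h.isFollower
        exact ⟨hG.of_isFollower hf, fun s hs => hs.of_isFollower hf⟩
    refine ⟨hH, h.equivalent hG hH.1 (by simp) ⟨?_, fun C hC => .inl ⟨C, by simp [hC], .refl C⟩⟩
      ⟨by simp, fun C hC => ?_⟩ fun C hC hne => by simp [hC, hne]⟩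
    · obtain ⟨C, hC⟩ := hB
      exact fun a ha => absurd ha (left_ne_atom hC a)
    · simp only [leftOptions_mk, Side.set_options, Finset.mem_union, Finset.mem_erase] at hC
      rcases hC with hC | hC
      · exact .inl ⟨C, hC.2, .refl C⟩
      · exact h.2.2.leftCovers.2 C hC
  | @eraseAtomic A B C l h hB hC hne hCG hS =>
    have hH := hG.replace_left hS fun C hC => hG.of_mem_left (Finset.mem_of_mem_erase hC)
    refine ⟨hH, h.equivalent hG hH.1 (by simp) (leftCovers_of_left_atom hB ?_)
      ⟨by simp, fun C hC => ?_⟩ fun C hC hne => by simp [hC, hne]⟩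
    · rw [← passLs_of_left_atom hB]
      refine h.2.2.passLs_le.trans (hCG.le.trans (passRs_le_passLs ?_))
      simp [hC, hne]
    · simp only [leftOptions_mk, Side.set_options, Finset.mem_erase] at hC
      exact .inl ⟨C, hC.2, .refl C⟩
  | @replaceAtomic A B l h hB hA =>
    have hBG := hG.of_isFollower h.isFollower
    have hA' : Guaranteed (mk (.atom l) (.options {B} (Finset.singleton_nonempty B))) ∧
        ∀ s, HasAtom (mk (.atom l) (.options {B} (Finset.singleton_nonempty B))) s →
          HasAtom B s := by
      have hatom : ∀ s, HasAtom (mk (.atom l) (.options {B} (Finset.singleton_nonempty B))) s →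
          HasAtom B s := by
        intro s hs
        rcases hasAtom_iff.1 hs with h' | h' | ⟨A, hA, h'⟩
        · exact hasAtom_of_left (hB.trans (by simpa using h'))
        · simp at h'
        · simp [IsOption] at hA
          exact hA ▸ h'
      refine ⟨guaranteed_iff.2 ⟨?_, fun l' hl' s hs => ?_, by simp⟩, hatom⟩
      · intro A hA
        simp [IsOption] at hA
        exact hA ▸ hBG
      · exact (hBG B .refl).1 l' (hB.trans (by simpa using hl')) s (hatom s hs)
    have hH := hG.replace_left (Finset.insert_nonempty _ (G.leftOptions.erase A)) fun C hC => by
      rcases Finset.mem_insert.1 hC with rfl | hC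
      · exact ⟨hA'.1, fun s hs => (hA'.2 s hs).of_isFollower h.isFollower⟩
      · exact hG.of_mem_left (Finset.mem_of_mem_erase hC)
    refine ⟨hH, h.equivalent hG hH.1 (by simp) (leftCovers_of_left_atom hB ?_)
      ⟨by simp, fun C hC => ?_⟩ fun C hC hne => by simp [hC, hne]⟩
    · refine (passRs_eq_of_atomic (left_mk (.atom l) _) ?_ ?_).ge.trans
        (passRs_le_passLs (A := mk (.atom l) (.options {B} (Finset.singleton_nonempty B))) ?_)
      · simp
      · simp [hB]
      · simp
    · simp only [leftOptions_mk, Side.set_options, Finset.mem_insert, Finset.mem_erase] at hC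
      rcases hC with rfl | hC
      · exact .inr ⟨B, by simp, h.2.2⟩
      · exact .inl ⟨C, hC.2, .refl C⟩
  | @substituteWait A B l n h hB hA hn =>
    have hH := hG.replace_left (Finset.insert_nonempty (subWait (number l) (n + 1))
      (G.leftOptions.erase A)) fun C hC => by
        rcases Finset.mem_insert.1 hC with rfl | hC
        · refine ⟨guaranteed_subWait_number l _, fun s hs => ?_⟩
          rw [hasAtom_subWait_number.1 hs]
          exact (hasAtom_of_left hB).of_isFollower h.isFollower
        · exact hG.of_mem_left (Finset.mem_of_mem_erase hC)
    refine ⟨hH, h.equivalent hG hH.1 (by simp) (leftCovers_of_left_atom hB ?_)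
      ⟨by simp, fun C hC => ?_⟩ fun C hC hne => by simp [hC, hne]⟩
    · refine (passRs_eq_of_atomic (left_subWait_number l (n + 1)) ?_ ?_).ge.trans
        (passRs_le_passLs ?_)
      · simp [rightOptions_subWait_number_succ]
      · simp [rightOptions_subWait_number_succ, left_subWait_number]
      · simp
    · simp only [leftOptions_mk, Side.set_options, Finset.mem_insert, Finset.mem_erase] at hC
      rcases hC with rfl | hC
      · exact .inr ⟨subWait (number l) n, by simp [rightOptions_subWait_number_succ], hn.1⟩
      · exact .inl ⟨C, hC.2, .refl C⟩
  | @substituteAtom A B l h hB hA hGA hguar =>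
    refine ⟨⟨hguar, fun s hs => ?_⟩, h.equivalent hG hguar (by simp)
      (leftCovers_of_left_atom hB ?_) (leftCovers_of_left_atom (left_mk _ _) ?_) ?_⟩
    · rcases hasAtom_iff.1 hs with h' | h' | ⟨C, hC | hC, h'⟩
      · exact (hasAtom_of_left (hB.trans (by simpa using h'))).of_isFollower h.isFollower
      · exact hasAtom_of_right (by simpa using h')
      · simp at hC
      · exact h'.of_isFollower (.single (.inr (by simpa [rightOptions] using hC)))
    · exact (passLs_of_left_atom (left_mk _ _)).ge
    · rw [← passLs_of_left_atom hB]
      exact h.2.2.passLs_le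
    · intro C hC hne
      rw [hGA, Finset.mem_singleton] at hC
      exact absurd hC hne

theorem Reduction.sound {G H : SGame} (h : Reduction G H) (hG : Guaranteed G) :
    (Guaranteed H ∧ ∀ s, HasAtom H s → HasAtom G s) ∧ Equivalent G H := by
  rcases h with h | h
  · exact h.sound hG
  · obtain ⟨⟨h₁, h₂⟩, h₃⟩ := h.sound hG.conj
    refine ⟨⟨guaranteed_conj.1 h₁, fun s hs => ?_⟩, equivalent_conj.1 h₃⟩
    have := h₂ (-s) (by rwa [hasAtom_conj, neg_neg])
    rwa [hasAtom_conj, neg_neg] at this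

/-- Soundness of a step passes from a Left option to the game. -/
theorem sound_replace_left {G A B : SGame} (hG : Guaranteed G) (hA : A ∈ G.leftOptions)
    (h : (Guaranteed B ∧ ∀ s, HasAtom B s → HasAtom A s) ∧ Equivalent A B) :
    (Guaranteed (mk (.options (insert B (G.leftOptions.erase A)) (Finset.insert_nonempty _ _))
        G.right) ∧
      ∀ s, HasAtom (mk (.options (insert B (G.leftOptions.erase A)) (Finset.insert_nonempty _ _))
        G.right) s → HasAtom G s) ∧
    Equivalent G (mk (.options (insert B (G.leftOptions.erase A)) (Finset.insert_nonempty _ _))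
        G.right) := by
  have hH := hG.replace_left (Finset.insert_nonempty B (G.leftOptions.erase A)) fun C hC => by
    rcases Finset.mem_insert.1 hC with rfl | hC
    · exact ⟨h.1.1, fun s hs => (hG.of_mem_left hA).2 s (h.1.2 s hs)⟩
    · exact hG.of_mem_left (Finset.mem_of_mem_erase hC)
  refine ⟨hH, equivalent_of_leftCovers hG hH.1 (by simp) ⟨by simp, fun C hC => .inl ?_⟩
    ⟨fun a ha => absurd ha (left_ne_atom hA a), fun C hC => .inl ?_⟩⟩
  · simp only [leftOptions_mk, Side.set_options, Finset.mem_insert, Finset.mem_erase] at hC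
    rcases hC with rfl | hC
    · exact ⟨A, hA, h.2.1⟩
    · exact ⟨C, hC.2, .refl C⟩
  · by_cases hCA : C = A
    · exact ⟨B, by simp, hCA ▸ h.2.2⟩
    · exact ⟨C, by simp [hC, hCA], .refl C⟩

theorem conj_mk_insert (G A B : SGame) :
    conj (mk G.left (.options (insert B (G.rightOptions.erase A)) (Finset.insert_nonempty _ _))) =
      mk (.options (insert (conj B) ((conj G).leftOptions.erase (conj A)))
        (Finset.insert_nonempty _ _)) (conj G).right := by
  apply ext_options
  · simp [leftOptions_conj, Finset.image_insert, Finset.image_erase conj_injective]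
  · rw [rightOptions_conj, leftOptions_mk, rightOptions_mk]
    exact (rightOptions_conj G).symm
  · simp [left_conj_eq_atom]
  · simp [right_conj_eq_atom]

theorem Step.sound {G H : SGame} (h : Step G H) (hG : Guaranteed G) :
    (Guaranteed H ∧ ∀ s, HasAtom H s → HasAtom G s) ∧ Equivalent G H := by
  induction h with
  | here h => exact h.sound hG
  | inLeft hA _ ih => exact sound_replace_left hG hA (ih (hG.of_isOption (.inl hA)))
  | @inRight G A B hA _ ih =>
    obtain ⟨⟨h₁, h₂⟩, h₃⟩ := ih (hG.of_isOption (.inr hA))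
    obtain ⟨⟨h₁, h₂⟩, h₃⟩ := sound_replace_left (B := conj B) hG.conj
      (conj_mem_leftOptions_conj.2 hA)
      ⟨⟨h₁.conj, fun s hs => hasAtom_conj.2 (h₂ _ (hasAtom_conj.1 hs))⟩, equivalent_conj.2 h₃⟩
    rw [← conj_mk_insert] at h₁ h₂ h₃
    refine ⟨⟨guaranteed_conj.1 h₁, fun s hs => ?_⟩, equivalent_conj.1 h₃⟩
    have := h₂ (-s) (by rwa [hasAtom_conj, neg_neg])
    rwa [hasAtom_conj, neg_neg] at this

/-! ### Termination -/

theorem IsDelayedNumber.of_isOption {A G : SGame} (hG : IsDelayedNumber G) (hA : IsOption A G) :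
    IsDelayedNumber A := by
  have key : ∀ l n A, IsOption A (subWait (number l) n) → IsDelayedNumber A := by
    rintro l (_ | n) A (hA | hA)
    · simp [leftOptions_eq_empty (left_subWait_number l _)] at hA
    · simp [subWait_zero, rightOptions_eq_empty (right_number l)] at hA
    · simp [leftOptions_eq_empty (left_subWait_number l _)] at hA
    · rw [rightOptions_subWait_number_succ, Finset.mem_singleton] at hA
      exact ⟨l, n, .inl hA⟩
  obtain ⟨l, n, rfl | rfl⟩ := hG
  · exact key l n A hA
  · exact isDelayedNumber_conj.1 (key l n _ (isOption_conj.1 hA))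

theorem IsDelayedNumber.eq_of_mem_leftOptions {G A C : SGame} (hG : IsDelayedNumber G)
    (hA : A ∈ G.leftOptions) (hC : C ∈ G.leftOptions) : A = C := by
  obtain ⟨l, n, rfl | rfl⟩ := hG
  · simp [leftOptions_eq_empty (left_subWait_number l _)] at hA
  · rw [mem_leftOptions_conj] at hA hC
    cases n with
    | zero => simp [subWait_zero, rightOptions_eq_empty (right_number l)] at hA
    | succ n =>
      rw [rightOptions_subWait_number_succ, Finset.mem_singleton] at hA hC
      exact conj_injective (hA.trans hC.symm)

theorem IsDelayedNumber.rightOptions_eq_empty {G A : SGame} (hG : IsDelayedNumber G)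
    (hA : A ∈ G.leftOptions) : A.rightOptions = ∅ := by
  obtain ⟨l, n, rfl | rfl⟩ := hG
  · simp [leftOptions_eq_empty (left_subWait_number l _)] at hA
  · rw [mem_leftOptions_conj] at hA
    cases n with
    | zero => simp [subWait_zero, SGame.rightOptions_eq_empty (right_number l)] at hA
    | succ n =>
      rw [rightOptions_subWait_number_succ, Finset.mem_singleton] at hA
      rw [← conj_conj A, hA, rightOptions_conj, leftOptions_eq_empty (left_subWait_number l _),
        Finset.image_empty]

theorem LeftReversible.not_isDelayedNumber {G A B : SGame} (h : LeftReversible G A B) :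
    ¬ IsDelayedNumber G := fun hG => by
  have := hG.rightOptions_eq_empty h.1
  exact absurd h.2.1 (by simp [this])

theorem weight_lt_weight {G H : SGame} (hG : ¬ IsDelayedNumber G)
    (h : ∑ A ∈ H.leftOptions, weight A + ∑ A ∈ H.rightOptions, weight A <
      ∑ A ∈ G.leftOptions, weight A + ∑ A ∈ G.rightOptions, weight A) : weight H < weight G := by
  rw [weight_eq G, weight_eq H, if_neg hG]
  split <;> omega

theorem sum_weight_insert_le (B : SGame) (S : Finset SGame) :
    ∑ A ∈ insert B S, weight A ≤ weight B + ∑ A ∈ S, weight A := by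
  by_cases h : B ∈ S
  · rw [Finset.insert_eq_of_mem h]; omega
  · rw [Finset.sum_insert h]

/-- The delayed number that may replace an option reversible through a left-atomic game weighs
less than that option. -/
theorem weight_subWait_number_lt {G A B : SGame} {l : ℝ} {n : ℕ} (hG : Guaranteed G)
    (h : LeftReversible G A B) (hB : B.left = .atom l)
    (hn : IsLeast {m : ℕ | Succeq G (subWait (number l) m)} n)
    (hA : A ≠ subWait (number l) (n + 1)) :
    weight (subWait (number l) (n + 1)) < weight A := by
  rw [weight_subWait_number]
  by_cases hD : IsDelayedNumber A
  · obtain ⟨l', k, rfl | rfl⟩ := hD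
    · have hBA := h.2.1
      cases k with
      | zero => simp [subWait_zero, rightOptions_eq_empty (right_number l')] at hBA
      | succ k =>
        rw [rightOptions_subWait_number_succ, Finset.mem_singleton] at hBA
        subst hBA
        rw [left_subWait_number] at hB
        injection hB with hB
        subst hB
        have hnk : n ≤ k := hn.2 h.2.2
        have hne : n ≠ k := fun e => hA (by rw [e])
        rw [weight_subWait_number]
        omega
    · have hBA := h.2.1
      simp [rightOptions_conj, leftOptions_eq_empty (left_subWait_number l' _)] at hBA
  · obtain ⟨m, hm, hBm⟩ :=
      exists_succeq_subWait_number (hG.of_isFollower h.isFollower) hB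
    have hnm : n ≤ m := hn.2 (h.2.2.trans hBm)
    have hw := Finset.single_le_sum (f := weight) (fun _ _ => Nat.zero_le _) h.2.1
    rw [weight_eq A, if_neg hD]
    omega

theorem LeftReversible.exists_isLeast {G A B : SGame} {l : ℝ} (hG : Guaranteed G)
    (h : LeftReversible G A B) (hB : B.left = .atom l) :
    ∃ n, IsLeast {m : ℕ | Succeq G (subWait (number l) m)} n := by
  obtain ⟨m, -, hBm⟩ := exists_succeq_subWait_number (hG.of_isFollower h.isFollower) hB
  have hex : ∃ m, Succeq G (subWait (number l) m) := ⟨m, h.2.2.trans hBm⟩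
  exact ⟨Nat.find hex, Nat.find_spec hex, fun k hk => Nat.find_min' hex hk⟩

/-- Whenever a reduction changes a position, some reduction makes it lighter. The reduction that
replaces `A` by `⟨∅ˡ ∣ B⟩` need not do so itself, but it can be exchanged for a replacement by
a delayed number. -/
theorem LeftReduction.exists_weight_lt {G H : SGame} (h : LeftReduction G H)
    (hG : Guaranteed G) (hne : H ≠ G) :
    ∃ H', LeftReduction G H' ∧ weight H' < weight G ∧ ¬ IsDelayedNumber G := by
  have hwait : ∀ {A B : SGame} {l : ℝ} {n : ℕ}, LeftReversible G A B → B.left = .atom l →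
      OnlyBest G A → IsLeast {m : ℕ | Succeq G (subWait (number l) m)} n →
      A ≠ subWait (number l) (n + 1) →
      ∃ H', LeftReduction G H' ∧ weight H' < weight G ∧ ¬ IsDelayedNumber G := by
    intro A B l n h hB hA hn hne
    refine ⟨_, .substituteWait h hB hA hn, ?_, h.not_isDelayedNumber⟩
    refine weight_lt_weight h.not_isDelayedNumber ?_
    have h₁ := weight_subWait_number_lt hG h hB hn hne
    have h₂ := sum_weight_insert_le (subWait (number l) (n + 1)) (G.leftOptions.erase A)
    have h₃ := Finset.add_sum_erase _ weight h.1
    simp only [leftOptions_mk, rightOptions_mk, Side.set_options]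
    change _ + ∑ A ∈ G.rightOptions, weight A < _
    omega
  have herase : ∀ {A : SGame} (hA : A ∈ G.leftOptions) (hS : (G.leftOptions.erase A).Nonempty),
      ¬ IsDelayedNumber G →
      weight (mk (.options (G.leftOptions.erase A) hS) G.right) < weight G := by
    intro A hA hS hD
    refine weight_lt_weight hD ?_
    have h₁ := weight_pos A
    have h₃ := Finset.add_sum_erase _ weight hA
    simp only [leftOptions_mk, rightOptions_mk, Side.set_options]
    change _ + ∑ A ∈ G.rightOptions, weight A < _
    omega
  cases h with
  | @dominated A B hA hB hAB h hS =>
    have hD : ¬ IsDelayedNumber G := fun hD => hAB (hD.eq_of_mem_leftOptions hA hB)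
    exact ⟨_, .dominated hA hB hAB h hS, herase hA hS hD, hD⟩
  | @bypass A B h hB hS =>
    refine ⟨_, .bypass h hB hS, weight_lt_weight h.not_isDelayedNumber ?_,
      h.not_isDelayedNumber⟩
    have h₁ := weight_lt_of_isOption (.inr h.2.1)
    have h₂ := weight_eq B
    have h₃ := Finset.add_sum_erase _ weight h.1
    have h₄ := Finset.sum_union_inter (s₁ := G.leftOptions.erase A) (s₂ := B.leftOptions)
      (f := weight)
    simp only [leftOptions_mk, rightOptions_mk, Side.set_options]
    change _ + ∑ A ∈ G.rightOptions, weight A < _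
    omega
  | @eraseAtomic A B C l h hB hC hCA hCG hS =>
    exact ⟨_, .eraseAtomic h hB hC hCA hCG hS, herase h.1 hS h.not_isDelayedNumber,
      h.not_isDelayedNumber⟩
  | @replaceAtomic A B l h hB hA =>
    obtain ⟨n, hn⟩ := h.exists_isLeast hG hB
    refine hwait h hB hA hn fun hAn => hne ?_
    have hBA := h.2.1
    rw [hAn, rightOptions_subWait_number_succ, Finset.mem_singleton] at hBA
    have hA' : mk (.atom l) (.options {B} (Finset.singleton_nonempty B)) = A := by
      rw [hAn, subWait_number_succ]
      subst hBA
      rfl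
    refine ext ?_ (right_mk _ _)
    rw [left_mk]
    refine (left_eq_options _ ?_).symm
    rw [hA', Finset.insert_erase h.1]
  | @substituteWait A B l n h hB hA hn =>
    refine hwait h hB hA hn fun hAn => hne ?_
    refine ext ?_ (right_mk _ _)
    rw [left_mk]
    refine (left_eq_options _ ?_).symm
    rw [← hAn, Finset.insert_erase h.1]
  | @substituteAtom A B l h hB hA hGA hguar =>
    refine ⟨_, .substituteAtom h hB hA hGA hguar, weight_lt_weight h.not_isDelayedNumber ?_,
      h.not_isDelayedNumber⟩
    have h₁ := weight_pos A
    rw [hGA, Finset.sum_singleton]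
    simp only [leftOptions_mk, rightOptions_mk, Side.set_atom, Finset.sum_empty]
    change _ + ∑ A ∈ G.rightOptions, weight A < _
    omega

theorem Reduction.exists_weight_lt {G H : SGame} (h : Reduction G H)
    (hG : Guaranteed G) (hne : H ≠ G) :
    ∃ H', Reduction G H' ∧ weight H' < weight G ∧ ¬ IsDelayedNumber G := by
  rcases h with h | h
  · obtain ⟨H', h₁, h₂⟩ := h.exists_weight_lt hG hne
    exact ⟨H', .inl h₁, h₂⟩
  · obtain ⟨H', h₁, h₂, h₃⟩ := h.exists_weight_lt hG.conj fun e => hne (conj_injective e)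
    refine ⟨conj H', .inr (by rwa [conj_conj]), ?_, fun h => h₃ (isDelayedNumber_conj.2 h)⟩
    rwa [weight_conj, ← weight_conj G]

/-- A step at a follower `F` that lowers its weight lowers the weight of the whole game. The
ancestors of `F` may become delayed numbers, which only helps; since `F` is not a delayed number,
none of them is one to begin with. -/
theorem exists_step_weight_lt {F F' G : SGame} (hF : IsFollower F G) (h : Step F F')
    (hw : weight F' < weight F) (hD : ¬ IsDelayedNumber F) :
    ∃ G', Step G G' ∧ weight G' < weight G ∧ ¬ IsDelayedNumber G := by
  induction hF with
  | refl => exact ⟨F', h, hw, hD⟩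
  | @tail A G _ hA ih =>
    obtain ⟨B, hAB, hw, hD⟩ := ih
    have hD : ¬ IsDelayedNumber G := fun hG => hD (hG.of_isOption hA)
    rcases hA with hA | hA
    · refine ⟨_, .inLeft hA hAB, weight_lt_weight hD ?_, hD⟩
      have h₂ := sum_weight_insert_le B (G.leftOptions.erase A)
      have h₃ := Finset.add_sum_erase _ weight hA
      simp only [leftOptions_mk, rightOptions_mk, Side.set_options]
      change _ + ∑ A ∈ G.rightOptions, weight A < _
      omega
    · refine ⟨_, .inRight hA hAB, weight_lt_weight hD ?_, hD⟩
      have h₂ := sum_weight_insert_le B (G.rightOptions.erase A)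
      have h₃ := Finset.add_sum_erase _ weight hA
      simp only [leftOptions_mk, rightOptions_mk, Side.set_options]
      change ∑ A ∈ G.leftOptions, weight A + _ < _
      omega

/-- Weight-decreasing steps lead to a reduced game. -/
theorem exists_isReduced {G : SGame} (hG : Guaranteed G) :
    ∃ K, Guaranteed K ∧ IsReduced K ∧ Equivalent K G ∧ ReducesTo G K := by
  induction hn : weight G using Nat.strong_induction_on generalizing G with
  | h n ih =>
  by_cases hred : IsReduced G
  · exact ⟨G, hG, hred, .refl G, .refl⟩
  · simp only [IsReduced, not_forall] at hred
    obtain ⟨F, hF, H, hFH, hne⟩ := hred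
    obtain ⟨F', hFF', hw, hD⟩ := hFH.exists_weight_lt (hG.of_isFollower hF) hne
    obtain ⟨G', hGG', hw, -⟩ := exists_step_weight_lt hF (.here hFF') hw hD
    have hs := hGG'.sound hG
    obtain ⟨K, h₁, h₂, h₃, h₄⟩ := ih _ (hn ▸ hw) hs.1.1 rfl
    exact ⟨K, h₁, h₂, h₃.trans hs.2.symm, .head hGG' h₄⟩

/-! ### Uniqueness of reduced games -/

theorem IsReduced.of_isOption {A G : SGame} (hG : IsReduced G) (hA : IsOption A G) :
    IsReduced A := fun F hF => hG F (.tail hF hA)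

theorem IsReduced.conj {G : SGame} (hG : IsReduced G) : IsReduced (conj G) := by
  intro F hF H hFH
  have := hG _ (isFollower_conj.1 hF) (SGame.conj H) (by
    rw [Reduction, conj_conj, conj_conj]
    exact hFH.symm)
  exact conj_injective this

theorem IsReduced.eq_of_leftReduction {G H : SGame} (hG : IsReduced G) (h : LeftReduction G H) :
    H = G := hG G .refl H (.inl h)

/-- `A` is a Left option of `G` that is reversible through some Right option of `A`. -/
def IsReversible (G A : SGame) : Prop := ∃ B, LeftReversible G A B

/-- In a reduced game, a reversible Left option is the delayed number `l - m̂`, `m = n + 1`, that is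
determined by the equivalence class of the game: `l` is the pass-allowed Left-stop, and `n` is
least such that the game is at least `l - n̂`. -/
theorem IsReduced.reversible {G A : SGame} (hR : IsReduced G) (hG : Guaranteed G)
    (h : IsReversible G A) : OnlyBest G A ∧
      (∃ n, A = subWait (number (passLs G)) (n + 1) ∧
        IsLeast {m : ℕ | Succeq G (subWait (number (passLs G)) m)} n) ∧
      (G.leftOptions = {A} → ¬ Guaranteed (mk (.atom (passLs G)) G.right)) := by
  obtain ⟨B, h⟩ := h
  have hleft : ∀ {S : Finset SGame} {hS : S.Nonempty},
      LeftReduction G (mk (.options S hS) G.right) → A ∈ S := by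
    intro S hS hr
    have := congrArg leftOptions (hR.eq_of_leftReduction hr)
    rw [leftOptions_mk, Side.set_options] at this
    rw [this]
    exact h.1
  have hB : ∃ l, B.left = .atom l := by
    by_contra! hne
    have hB := leftOptions_nonempty_of_ne hne
    have hA := hleft (.bypass h hB (hB.mono Finset.subset_union_right))
    rw [Finset.mem_union] at hA
    rcases hA with hA | hA
    · simp at hA
    · have h₁ := weight_lt_of_isOption (.inl hA)
      have h₂ := weight_lt_of_isOption (.inr h.2.1)
      omega
  obtain ⟨l, hB⟩ := hB
  have hbest : ∀ C ∈ G.leftOptions, C ≠ A → passLs G ≠ passRs C := by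
    intro C hC hne hCG
    have hA := hleft (.eraseAtomic h hB hC hne hCG ⟨C, Finset.mem_erase.2 ⟨hne, hC⟩⟩)
    simp at hA
  have honly : OnlyBest G A := by
    obtain ⟨D, hD, hDG⟩ := exists_passLs_eq hG ⟨A, h.1⟩
    have hDA : D = A := by
      by_contra hne
      exact hbest D hD hne hDG
    subst hDA
    refine ⟨hDG, fun C hC hne => ?_⟩
    rw [← hDG]
    exact (passRs_le_passLs hC).lt_of_ne (hbest C hC hne).symm
  obtain ⟨n, hn⟩ := h.exists_isLeast hG hB
  have hA : A = subWait (number l) (n + 1) := by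
    have hA := hleft (.substituteWait h hB honly hn)
    simpa using hA
  have hl : passLs G = l := by
    rw [honly.1, hA]
    apply passRs_eq_of_atomic (left_subWait_number l _)
    · simp [rightOptions_subWait_number_succ]
    · simp [rightOptions_subWait_number_succ, left_subWait_number]
  rw [hl]
  refine ⟨honly, ⟨n, hA, hn⟩, fun hGA hguar => ?_⟩
  have := hR.eq_of_leftReduction (.substituteAtom h hB honly hGA hguar)
  exact left_ne_atom h.1 l (by rw [← this, left_mk])

theorem IsReversible.congr {G H A : SGame} (h : IsReversible G A) (hHG : Succeq H G)
    (hA : A ∈ H.leftOptions) : IsReversible H A := by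
  obtain ⟨B, hB⟩ := h
  exact ⟨B, hA, hB.2.1, hHG.trans hB.2.2⟩

/-- The conditions of the comparison `G ≽ H` that concern Right's side of `G`. -/
theorem Succeq.rightCovers {G H A : SGame} (h : Succeq G H) (hA : A ∈ G.rightOptions) :
    (∃ C ∈ H.rightOptions, Succeq A C) ∨ ∃ B ∈ A.leftOptions, Succeq B H := by
  rcases (succeq_conj.2 h).leftCovers.2 _ (conj_mem_leftOptions_conj.2 hA) with
    ⟨C, hC, hCA⟩ | ⟨B, hB, hHB⟩
  · refine .inl ⟨conj C, mem_leftOptions_conj.1 hC, ?_⟩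
    rwa [← succeq_conj, conj_conj]
  · refine .inr ⟨conj B, mem_rightOptions_conj.1 hB, ?_⟩
    rwa [← succeq_conj, conj_conj]

/-- Of two equivalent reduced games, the irreversible Left options of the one are Left options
of the other. -/
theorem mem_leftOptions_of_not_isReversible {G H C : SGame} (hG : Guaranteed G)
    (hRG : IsReduced G) (hRH : IsReduced H) (hGH : Equivalent G H)
    (heq : ∀ A ∈ G.leftOptions, ∀ B ∈ H.leftOptions, Equivalent A B → A = B)
    (hC : C ∈ H.leftOptions) (hCr : ¬ IsReversible H C) : C ∈ G.leftOptions := by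
  rcases hGH.1.leftCovers.2 C hC with ⟨D, hD, hDC⟩ | ⟨B, hB, hGB⟩
  · rcases hGH.2.leftCovers.2 D hD with ⟨C', hC', hCD⟩ | ⟨B, hB, hHB⟩
    · have hCC : C = C' := by
        by_contra hne
        have hS : (H.leftOptions.erase C).Nonempty :=
          ⟨C', Finset.mem_erase.2 ⟨Ne.symm hne, hC'⟩⟩
        have := congrArg leftOptions
          (hRH.eq_of_leftReduction (.dominated hC hC' hne (hCD.trans hDC) hS))
        rw [leftOptions_mk, Side.set_options, Finset.erase_eq_self] at this
        exact this hC
      subst hCC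
      rwa [← heq D hD C hC ⟨hDC, hCD⟩]
    · -- Here `D = l - m̂` with `m = n + 1`. Its only Right option `l - n̂` would have to be at
      -- least a Right option of `C`, through which `C` would then be reversible in `H`.
      obtain ⟨-, ⟨n, hDn, hn⟩, -⟩ := hRG.reversible hG ⟨B, hD, hB, hGH.1.trans hHB⟩
      have hmem : subWait (number (passLs G)) n ∈ D.rightOptions := by
        rw [hDn, rightOptions_subWait_number_succ, Finset.mem_singleton]
      rcases hDC.rightCovers hmem with ⟨E, hE, hnE⟩ | ⟨E, hE, -⟩
      · exact absurd ⟨E, hC, hE, hGH.2.trans (hn.1.trans hnE)⟩ hCr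
      · simp [leftOptions_eq_empty (left_subWait_number _ n)] at hE
  · exact absurd ⟨B, hC, hB, hGH.2.trans hGB⟩ hCr

theorem Equivalent.passLs_eq {G H : SGame} (h : Equivalent G H) : passLs G = passLs H :=
  le_antisymm h.2.passLs_le h.1.passLs_le

/-- A reversible Left option of a reduced game is a Left option of every equivalent reduced
game that has any reversible Left option. -/
theorem mem_leftOptions_of_isReversible {G H A C : SGame} (hG : Guaranteed G)
    (hH : Guaranteed H) (hRG : IsReduced G) (hRH : IsReduced H) (hGH : Equivalent G H)
    (hA : IsReversible G A) (hC : IsReversible H C) : C ∈ G.leftOptions := by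
  obtain ⟨-, ⟨n, hAn, hn⟩, -⟩ := hRG.reversible hG hA
  obtain ⟨-, ⟨m, hCm, hm⟩, -⟩ := hRH.reversible hH hC
  have hset : {k : ℕ | Succeq H (subWait (number (passLs H)) k)} =
      {k : ℕ | Succeq G (subWait (number (passLs G)) k)} := by
    ext k
    rw [Set.mem_ofPred_eq, Set.mem_ofPred_eq, hGH.passLs_eq]
    exact ⟨fun h => hGH.1.trans h, fun h => hGH.2.trans h⟩
  rw [hset] at hm
  rw [hCm, ← hGH.passLs_eq, hm.unique hn, ← hAn]
  obtain ⟨B, hB⟩ := hA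
  exact hB.1

/-- Left's side of `G` is the atom that could replace Left's only option in `H`, except that the
resulting game would not be guaranteed. -/
def LeftAtomVersus (G H : SGame) : Prop :=
  ∃ l n, G.left = .atom l ∧ H.leftOptions = {subWait (number l) (n + 1)} ∧
    ¬ Guaranteed (mk (.atom l) H.right)

/-- If only `H` has a reversible Left option, then Left's side of `G` is an atom: the options of
`G` would all be irreversible, hence options of `H`, and none of them would achieve the common
pass-allowed stop. -/
theorem leftAtomVersus_of_isReversible {G H A : SGame} (hG : Guaranteed G)
    (hH : Guaranteed H) (hRG : IsReduced G) (hRH : IsReduced H) (hGH : Equivalent G H)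
    (heq : ∀ A ∈ G.leftOptions, ∀ B ∈ H.leftOptions, Equivalent A B → A = B)
    (hA : IsReversible H A) (hno : ¬ ∃ C, IsReversible G C) : LeftAtomVersus G H := by
  obtain ⟨hbest, ⟨n, hAn, -⟩, hguar⟩ := hRH.reversible hH hA
  have hempty : ¬ G.leftOptions.Nonempty := by
    intro hne
    obtain ⟨D, hD, hDG⟩ := exists_passLs_eq hG hne
    have hDH : D ∈ H.leftOptions := mem_leftOptions_of_not_isReversible hH hRH hRG hGH.symm
      (fun A hA B hB h => (heq B hB A hA h.symm).symm) hD fun h => hno ⟨D, h⟩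
    by_cases hDA : D = A
    · subst hDA
      exact hno ⟨D, hA.congr hGH.1 hD⟩
    · have := hbest.2 D hDH hDA
      rw [← hDG, ← hbest.1, hGH.passLs_eq] at this
      exact lt_irrefl _ this
  have hatom : ∃ l, G.left = .atom l := by
    by_contra! h
    exact hempty (leftOptions_nonempty_of_ne h)
  obtain ⟨l, hl⟩ := hatom
  have hlH : passLs H = l := by rw [← hGH.passLs_eq, passLs_of_left_atom hl]
  rw [hlH] at hAn hguar
  have hHA : H.leftOptions = {A} := by
    refine Finset.eq_singleton_iff_unique_mem.2 ⟨hA.choose_spec.1, fun C hC => ?_⟩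
    by_contra hne
    have hCr : IsReversible H C := by
      by_contra hCr
      exact hempty ⟨C, mem_leftOptions_of_not_isReversible hG hRG hRH hGH heq hC hCr⟩
    -- Two different options cannot both be the only best one.
    have h₁ := hbest.2 C hC hne
    have h₂ := (hRH.reversible hH hCr).1.2 A hA.choose_spec.1 (Ne.symm hne)
    exact lt_asymm h₁ h₂
  exact ⟨l, n, hl, hHA.trans (by rw [hAn]), hguar hHA⟩

theorem leftOptions_subset {G H : SGame} (hG : Guaranteed G)
    (hH : Guaranteed H) (hRG : IsReduced G) (hRH : IsReduced H) (hGH : Equivalent G H)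
    (heq : ∀ A ∈ G.leftOptions, ∀ B ∈ H.leftOptions, Equivalent A B → A = B)
    (hrev : (∃ C, IsReversible H C) → ∃ A, IsReversible G A) :
    H.leftOptions ⊆ G.leftOptions := by
  intro C hC
  by_cases hCr : IsReversible H C
  · obtain ⟨A, hA⟩ := hrev ⟨C, hCr⟩
    exact mem_leftOptions_of_isReversible hG hH hRG hRH hGH hA hCr
  · exact mem_leftOptions_of_not_isReversible hG hRG hRH hGH heq hC hCr

/-- The Left sides of equivalent reduced games agree, except possibly that one is an atom where
the other is a single delayed number. -/
theorem left_eq_or_leftAtomVersus {G H : SGame} (hG : Guaranteed G)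
    (hH : Guaranteed H) (hRG : IsReduced G) (hRH : IsReduced H) (hGH : Equivalent G H)
    (heq : ∀ A ∈ G.leftOptions, ∀ B ∈ H.leftOptions, Equivalent A B → A = B) :
    G.left = H.left ∨ LeftAtomVersus G H ∨ LeftAtomVersus H G := by
  have heq' : ∀ A ∈ H.leftOptions, ∀ B ∈ G.leftOptions, Equivalent A B → A = B :=
    fun A hA B hB h => (heq B hB A hA h.symm).symm
  by_cases h : (∃ C, IsReversible H C) ↔ ∃ A, IsReversible G A
  · left
    have hset : G.leftOptions = H.leftOptions :=
      (leftOptions_subset hH hG hRH hRG hGH.symm heq' h.2).antisymm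
        (leftOptions_subset hG hH hRG hRH hGH heq h.1)
    have key : ∀ {G H : SGame}, Equivalent G H → G.leftOptions = H.leftOptions →
        ∀ s, G.left = .atom s → H.left = .atom s := by
      intro G H hGH hset s hs
      obtain ⟨t, ht⟩ := Side.set_eq_empty.1 (hset.symm.trans (leftOptions_eq_empty hs))
      rw [ht, ← passLs_of_left_atom ht, ← hGH.passLs_eq, passLs_of_left_atom hs]
    exact Side.ext_iff'.2 ⟨hset, fun s => ⟨key hGH hset s, key hGH.symm hset.symm s⟩⟩
  · right
    by_cases hHr : ∃ C, IsReversible H C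
    · obtain ⟨A, hA⟩ := hHr
      exact .inl (leftAtomVersus_of_isReversible hG hH hRG hRH hGH heq hA
        fun hGr => h ⟨fun _ => hGr, fun _ => ⟨A, hA⟩⟩)
    · have hGr : ∃ A, IsReversible G A := by
        by_contra hGr
        exact h ⟨fun h => absurd h hHr, fun h => absurd h hGr⟩
      obtain ⟨A, hA⟩ := hGr
      exact .inr (leftAtomVersus_of_isReversible hH hG hRH hRG hGH.symm heq' hA hHr)

/-- The atom `∅ˢ` occurs on Left's side of `G`. -/
def HasLeftAtom (G : SGame) (s : ℝ) : Prop :=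
  G.left = .atom s ∨ ∃ A ∈ G.leftOptions, HasAtom A s

/-- In all three cases of `left_eq_or_leftAtomVersus`, the Left sides have the same atoms. -/
theorem HasLeftAtom.of_leftAtomVersus {G H : SGame} {s : ℝ}
    (h : G.left = H.left ∨ LeftAtomVersus G H ∨ LeftAtomVersus H G) (hs : HasLeftAtom H s) :
    HasLeftAtom G s := by
  rcases h with h | ⟨l, n, hl, hH, -⟩ | ⟨l, n, hl, hG, -⟩
  · rw [HasLeftAtom, leftOptions, h]
    exact hs
  · rcases hs with hs | ⟨A, hA, hs⟩
    · rw [leftOptions_eq_empty hs] at hH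
      exact absurd hH.symm (Finset.singleton_ne_empty _)
    · rw [hH, Finset.mem_singleton] at hA
      rw [hA, hasAtom_subWait_number] at hs
      exact .inl (hs ▸ hl)
  · rcases hs with hs | ⟨A, hA, hs⟩
    · rw [hl] at hs
      injection hs with hs
      exact .inr ⟨_, by rw [hG, Finset.mem_singleton], hasAtom_subWait_number.2 hs.symm⟩
    · exact absurd hl (left_ne_atom hA l)

/-- As the sides of Right have the same atoms in both games, putting the Left atom of the
guaranteed game `G` into `H` would yield a guaranteed game, so the exceptional case does not
arise. -/
theorem not_leftAtomVersus {G H : SGame} (hG : Guaranteed G) (hH : Guaranteed H)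
    (h : ∀ s, HasLeftAtom (conj H) s → HasLeftAtom (conj G) s) : ¬ LeftAtomVersus G H := by
  rintro ⟨l, n, hl, -, hguar⟩
  have hle : ∀ s, HasLeftAtom (conj H) s → l ≤ -s := by
    intro s hs
    refine (hG G .refl).1 l hl _ ?_
    rw [← hasAtom_conj]
    rcases h s hs with h | ⟨A, hA, h⟩
    · exact hasAtom_of_left h
    · exact h.of_isFollower (.single (.inl hA))
  have hatom : ∀ s, HasAtom (mk (.atom l) H.right) s → s = l ∨ HasLeftAtom (conj H) (-s) := by
    intro s hs
    rcases hasAtom_iff.1 hs with h | h | ⟨A, hA | hA, h⟩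
    · rw [left_mk] at h
      injection h with h
      exact .inl h.symm
    · exact .inr (.inl (left_conj_eq_atom.2 (by rw [neg_neg, ← h, right_mk])))
    · simp at hA
    · rw [rightOptions_mk] at hA
      exact .inr (.inr ⟨conj A, conj_mem_leftOptions_conj.2 hA,
        hasAtom_conj.2 (by rwa [neg_neg])⟩)
  refine hguar (guaranteed_iff.2 ⟨?_, fun l' hl' s hs => ?_, fun r hr s hs => ?_⟩)
  · rintro A (hA | hA)
    · simp at hA
    · exact hH.of_isOption (.inr (by simpa [rightOptions] using hA))
  · rw [left_mk] at hl'
    injection hl' with hl'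
    rw [← hl']
    rcases hatom s hs with rfl | hs
    · exact le_rfl
    · simpa using hle _ hs
  · rw [right_mk] at hr
    rcases hatom s hs with rfl | hs
    · have hr' : (conj H).left = .atom (-r) := left_conj_eq_atom.2 (by rw [neg_neg, hr])
      simpa using hle _ (.inl hr')
    · have hr' : (conj H).left = .atom (-r) := left_conj_eq_atom.2 (by rw [neg_neg, hr])
      rcases hs with hs | ⟨A, hA, -⟩
      · rw [hr'] at hs
        injection hs with hs
        linarith
      · exact absurd hr' (left_ne_atom hA _)

/-- Equivalent reduced guaranteed games are identical. -/
theorem eq_of_equivalent_of_isReduced {G H : SGame} (hG : Guaranteed G)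
    (hH : Guaranteed H) (hRG : IsReduced G) (hRH : IsReduced H) (hGH : Equivalent G H) :
    G = H := by
  induction G using induction generalizing H with
  | h G ih =>
  have heq : ∀ A, IsOption A G → ∀ B, IsOption B H → Equivalent A B → A = B :=
    fun A hA B hB h => ih A hA (hG.of_isOption hA) (hH.of_isOption hB) (hRG.of_isOption hA)
      (hRH.of_isOption hB) h
  have hl := left_eq_or_leftAtomVersus hG hH hRG hRH hGH
    fun A hA B hB => heq A (.inl hA) B (.inl hB)
  have hr := left_eq_or_leftAtomVersus hG.conj hH.conj hRG.conj hRH.conj (equivalent_conj.2 hGH)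
    fun A hA B hB h => conj_injective (heq _ (.inr (mem_leftOptions_conj.1 hA)) _
      (.inr (mem_leftOptions_conj.1 hB)) (equivalent_conj.2 h))
  have swap : ∀ {G H : SGame}, (G.left = H.left ∨ LeftAtomVersus G H ∨ LeftAtomVersus H G) →
      (H.left = G.left ∨ LeftAtomVersus H G ∨ LeftAtomVersus G H) :=
    fun h => h.imp Eq.symm Or.symm
  have key : ∀ {G H : SGame}, Guaranteed G → Guaranteed H →
      (G.left = H.left ∨ LeftAtomVersus G H ∨ LeftAtomVersus H G) →
      ((conj G).left = (conj H).left ∨ LeftAtomVersus (conj G) (conj H) ∨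
        LeftAtomVersus (conj H) (conj G)) → G.left = H.left := by
    intro G H hG hH hl hr
    rcases hl with h | h | h
    · exact h
    · exact absurd h (not_leftAtomVersus hG hH fun s hs => hs.of_leftAtomVersus hr)
    · exact absurd h (not_leftAtomVersus hH hG fun s hs => hs.of_leftAtomVersus (swap hr))
  have h₁ := key hG hH hl hr
  have h₂ := key hG.conj hH.conj hr (by simpa using hl)
  have h₃ : (conj (conj G)).right = (conj (conj H)).right := by
    have hc : ∀ {G H : SGame}, G.left = H.left → (conj G).right = (conj H).right := by
      intro G H h
      rw [Side.ext_iff']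
      refine ⟨?_, fun s => by rw [right_conj_eq_atom, right_conj_eq_atom, h]⟩
      change (conj G).rightOptions = (conj H).rightOptions
      rw [rightOptions_conj, rightOptions_conj, leftOptions, leftOptions, h]
    exact hc h₂
  rw [conj_conj, conj_conj] at h₃
  exact ext h₁ h₃

end SGame

theorem IsReducedForm.unique {K K' G : GS} (h : IsReducedForm K G) (h' : IsReducedForm K' G) :
    K' = K :=
  Subtype.ext (SGame.eq_of_equivalent_of_isReduced K'.2 K.2 h'.1 h.1 (h'.2.trans h.2.symm))

end ScoringGame

theorem mainTheorem3 :
    (∀ G : ScoringGame.GS, ∃ K : ScoringGame.GS,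
      (ScoringGame.IsReducedForm K G ∧ ScoringGame.SGame.ReducesTo G.1 K.1) ∧
      ∀ K' : ScoringGame.GS, ScoringGame.IsReducedForm K' G → K' = K) ∧
    (∀ c : ScoringGame.gsCon.Quotient, ∃! K : ScoringGame.GS,
      ScoringGame.SGame.IsReduced K.1 ∧ (K : ScoringGame.gsCon.Quotient) = c) := by
  have key : ∀ G : ScoringGame.GS, ∃ K : ScoringGame.GS,
      (ScoringGame.IsReducedForm K G ∧ ScoringGame.SGame.ReducesTo G.1 K.1) ∧
      ∀ K' : ScoringGame.GS, ScoringGame.IsReducedForm K' G → K' = K := by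
    intro G
    obtain ⟨K, hK, hred, hequiv, hto⟩ := ScoringGame.SGame.exists_isReduced G.2
    have hform : ScoringGame.IsReducedForm ⟨K, hK⟩ G := ⟨hred, hequiv⟩
    exact ⟨⟨K, hK⟩, ⟨hform, hto⟩, fun K' hK' =>
      hform.unique hK'⟩
  refine ⟨key, fun c => ?_⟩
  induction c using AddCon.induction_on with
  | H G =>
  obtain ⟨K, ⟨hK, -⟩, huniq⟩ := key G
  exact ⟨K, ⟨hK.1, (AddCon.eq _).2 hK.2⟩, fun K' hK' =>
    huniq K' ⟨hK'.1, (AddCon.eq _).1 hK'.2⟩⟩
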